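/- Let $f_1,f_2:\mathbb R^n\times\mathbb R^k\times\mathbb R\to\mathbb R^n$, $L_1,L_2:\mathbb R^n\times\mathbb R^k\times\mathbb R\to\mathbb R$, $g:\mathbb R^n\times\mathbb R\to\mathbb R$ and $\phi:\mathbb R^n\to\mathbb R$ be $C^1$; let $t_0,t_f\in\mathbb R$, $x_0,x_f\in\mathbb R^n$, and let $W\subseteq\mathbb R^n$ be a linear subspace ($W=\{0\}$: prescribed terminal state; $W=\mathbb R^n$: free terminal state). An admissible process $(x,u_1,u_2,\tau)$ consists of a crossing time $\tau\in(t_0,t_f)$, continuous controls $u_1$ on $[t_0,\tau]$ and $u_2$ on $[\tau,t_f]$, and a continuous state $x$ on $[t_0,t_f]$ with $x(t_0)=x_0$, $x(t_f)\in x_f+W$, $\dot x=f_1(x,u_1,t)$ on $[t_0,\tau]$, $\dot x=f_2(x,u_2,t)$ on $[\tau,t_f]$, such that $g(x(t),t)$ is negative for $t_0\le t<\tau$, zero at $t=\tau$, and positive for $\tau<t\le t_f$. Its performance index is $$J=\phi(x(t_f))+\int_{t_0}^{\tau}L_1(x,u_1,t)\,dt+\int_{\tau}^{t_f}L_2(x,u_2,t)\,dt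 .$$ Let $(x,u_1,u_2,\tau)$ minimize (or maximize) $J$ among all admissible processes. Put $m=\frac{\partial g}{\partial x}(x(\tau),\tau)$ (as a column vector) and $\mu=\frac{\partial g}{\partial t}(x(\tau),\tau)$; for the interface $m^{\top}x+\mu t+c=0$ these are the given $m$ and $\mu$, and in general they define the tangent plane of the interface at the switching point if $(m,\mu)\ne0$. Write $f_i,L_i$ without arguments for the values at $(x(\tau),u_i(\tau),\tau)$. Assume that the crossing is transversal: $m^{\top}f_1+\mu\neq0$ and $m^{\top}f_2+\mu\ne 0$. Let $H_i(x,\lambda,u,t)=L_i(x,u,t)+\lambda^{\top}f_i(x,u,t)$. Call $(\lambda_1,\lambda_2,\nu)$, with $\lambda_1:[t_0,\tau]\to\mathbb R^n$, $\lambda_2:[\tau,t_f]\to\mathbb R^n$ and $\nu\in\mathbb R$, a co-state along the process if, with all derivatives of $H_i$ taken along the process, - $\dot\lambda_1=-(\partial H_1/\partial x)^{\top}$ and $\partial H_1/\partial u=0$ on $[t_0,\tau]$; $\dot\lambda_2=-(\partial H_2/\partial x)^{\top}$ and $\partial H_2/\partial u=0$ on $[\tau,t_f]$; - $\lambda_2(t_f)-\nabla\phi(x(t_f))\perp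 W$; - $\lambda_2(\tau)-\lambda_1(\tau)+\nu m=0$, and $H_2-H_1=\nu\mu$ at the crossing. (Equivalently, with time as an additional state with co-state $\lambda_t$: the augmented co-state $(\lambda,\lambda_t)$ jumps by $-\nu(m,\mu)$ and the augmented Hamiltonian $H+\lambda_t$ is continuous.) If $W\neq\mathbb R^n$, assume also that the process is normal: in every co-state along it for the problem with $L_1,L_2,\phi$ replaced by $0$, both $\lambda_1$ and $\lambda_2$ vanish identically. Then $\langle m^{\top}f+\mu\rangle>0$, there exists a co-state along the process, and every co-state satisfies the jump law $$\Delta\lambda=-\frac{(\Delta L+\langle\lambda\rangle^{\top}\Delta f)\,m}{\langle m^{\top}f+\mu\rangle},$$ where $\Delta\lambda=\lambda_2(\tau)-\lambda_1(\tau)$, $\Delta L=L_2-L_1$, $\Delta f=f_2-f_1$, $\langle\lambda\rangle=\tfrac12(\lambda_1(\tau)+\lambda_2(\tau))$ and $\langle m^{\top}f+\mu\rangle=\tfrac12\big((m^{\top}f_1+\mu)+(m^{\top}f_2+\mu)\big)$. -/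

import Mathlib

/-- Data of a two-mode optimal control problem on `[t₀, t_f]`, with state space `ℝⁿ`, control space
`ℝᵏ` and a time-varying switching interface `g(x,t) = 0`: mode 1 is active where `g < 0`, mode 2
where `g > 0`. The terminal state is required to lie in `x_f + W`; so `W = ⊥` is the problem with
prescribed terminal state, and `W = ⊤` is the problem with free terminal state. -/
structure SwitchedProblem (n k : ℕ) where
  /-- dynamics of mode 1 -/
  f₁ : EuclideanSpace ℝ (Fin n) → EuclideanSpace ℝ (Fin k) → ℝ → EuclideanSpace ℝ (Fin n)
  /-- dynamics of mode 2 -/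
  f₂ : EuclideanSpace ℝ (Fin n) → EuclideanSpace ℝ (Fin k) → ℝ → EuclideanSpace ℝ (Fin n)
  /-- stage cost of mode 1 -/
  L₁ : EuclideanSpace ℝ (Fin n) → EuclideanSpace ℝ (Fin k) → ℝ → ℝ
  /-- stage cost of mode 2 -/
  L₂ : EuclideanSpace ℝ (Fin n) → EuclideanSpace ℝ (Fin k) → ℝ → ℝ
  /-- interface function -/
  g : EuclideanSpace ℝ (Fin n) → ℝ → ℝ
  /-- terminal cost -/
  φ : EuclideanSpace ℝ (Fin n) → ℝ
  /-- initial time -/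
  t₀ : ℝ
  /-- final time -/
  t_f : ℝ
  /-- initial state -/
  x₀ : EuclideanSpace ℝ (Fin n)
  /-- a point of the terminal set -/
  x_f : EuclideanSpace ℝ (Fin n)
  /-- direction of the terminal set -/
  W : Submodule ℝ (EuclideanSpace ℝ (Fin n))

namespace SwitchedProblem

/-- All data are continuously differentiable. -/
structure IsSmooth {n k : ℕ} (P : SwitchedProblem n k) : Prop where
  f₁ : ContDiff ℝ 1 (fun q : EuclideanSpace ℝ (Fin n) × EuclideanSpace ℝ (Fin k) × ℝ =>
    P.f₁ q.1 q.2.1 q.2.2)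
  f₂ : ContDiff ℝ 1 (fun q : EuclideanSpace ℝ (Fin n) × EuclideanSpace ℝ (Fin k) × ℝ =>
    P.f₂ q.1 q.2.1 q.2.2)
  L₁ : ContDiff ℝ 1 (fun q : EuclideanSpace ℝ (Fin n) × EuclideanSpace ℝ (Fin k) × ℝ =>
    P.L₁ q.1 q.2.1 q.2.2)
  L₂ : ContDiff ℝ 1 (fun q : EuclideanSpace ℝ (Fin n) × EuclideanSpace ℝ (Fin k) × ℝ =>
    P.L₂ q.1 q.2.1 q.2.2)
  g : ContDiff ℝ 1 (fun q : EuclideanSpace ℝ (Fin n) × ℝ => P.g q.1 q.2)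
  φ : ContDiff ℝ 1 P.φ

/-- `(x, u₁, u₂, τ)` is an admissible process: `x` is continuous, starts at `x₀`, ends in the
terminal set, crosses the interface exactly once, at the time `τ`, from `g < 0` to `g > 0`, and
obeys the dynamics of the active mode, under a control which is `u₁` before and `u₂` after the
crossing, each continuous up to the crossing time. (Continuity of `x` on `[t₀, t_f]` is a
consequence of the two differential equations.) -/
structure IsAdmissible {n k : ℕ} (P : SwitchedProblem n k) (x : ℝ → EuclideanSpace ℝ (Fin n))
    (u₁ u₂ : ℝ → EuclideanSpace ℝ (Fin k)) (τ : ℝ) : Prop where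
  mem_Ioo : τ ∈ Set.Ioo P.t₀ P.t_f
  initial : x P.t₀ = P.x₀
  terminal : x P.t_f - P.x_f ∈ P.W
  continuousOn₁ : ContinuousOn u₁ (Set.Icc P.t₀ τ)
  continuousOn₂ : ContinuousOn u₂ (Set.Icc τ P.t_f)
  dynamics₁ : ∀ t ∈ Set.Icc P.t₀ τ,
    HasDerivWithinAt x (P.f₁ (x t) (u₁ t) t) (Set.Icc P.t₀ τ) t
  dynamics₂ : ∀ t ∈ Set.Icc τ P.t_f,
    HasDerivWithinAt x (P.f₂ (x t) (u₂ t) t) (Set.Icc τ P.t_f) t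
  before : ∀ t ∈ Set.Ico P.t₀ τ, P.g (x t) t < 0
  crossing : P.g (x τ) τ = 0
  after : ∀ t ∈ Set.Ioc τ P.t_f, 0 < P.g (x t) t

/-- The performance index `J`. -/
noncomputable def cost {n k : ℕ} (P : SwitchedProblem n k) (x : ℝ → EuclideanSpace ℝ (Fin n))
    (u₁ u₂ : ℝ → EuclideanSpace ℝ (Fin k)) (τ : ℝ) : ℝ :=
  P.φ (x P.t_f) + (∫ t in P.t₀..τ, P.L₁ (x t) (u₁ t) t) + ∫ t in τ..P.t_f, P.L₂ (x t) (u₂ t) t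

/-- `(x, u₁, u₂, τ)` is an admissible process which minimizes, or maximizes, the performance index
among all admissible processes. -/
def IsOptimal {n k : ℕ} (P : SwitchedProblem n k) (x : ℝ → EuclideanSpace ℝ (Fin n))
    (u₁ u₂ : ℝ → EuclideanSpace ℝ (Fin k)) (τ : ℝ) : Prop :=
  P.IsAdmissible x u₁ u₂ τ ∧
    ((∀ y v₁ v₂ σ, P.IsAdmissible y v₁ v₂ σ → P.cost x u₁ u₂ τ ≤ P.cost y v₁ v₂ σ) ∨
      (∀ y v₁ v₂ σ, P.IsAdmissible y v₁ v₂ σ → P.cost y v₁ v₂ σ ≤ P.cost x u₁ u₂ τ))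

/-- Hamiltonian `H₁ = L₁ + λᵀ f₁` of mode 1. -/
noncomputable def H₁ {n k : ℕ} (P : SwitchedProblem n k) (x p : EuclideanSpace ℝ (Fin n))
    (u : EuclideanSpace ℝ (Fin k)) (t : ℝ) : ℝ :=
  P.L₁ x u t + inner ℝ p (P.f₁ x u t)

/-- Hamiltonian `H₂ = L₂ + λᵀ f₂` of mode 2. -/
noncomputable def H₂ {n k : ℕ} (P : SwitchedProblem n k) (x p : EuclideanSpace ℝ (Fin n))
    (u : EuclideanSpace ℝ (Fin k)) (t : ℝ) : ℝ :=
  P.L₂ x u t + inner ℝ p (P.f₂ x u t)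

/-- `m = ∂g/∂x`, the gradient of the interface function with respect to the state. -/
noncomputable def normal {n k : ℕ} (P : SwitchedProblem n k) (x : EuclideanSpace ℝ (Fin n))
    (t : ℝ) : EuclideanSpace ℝ (Fin n) :=
  gradient (fun y => P.g y t) x

/-- `μ = ∂g/∂t`, the partial derivative of the interface function with respect to time. -/
noncomputable def timeSlope {n k : ℕ} (P : SwitchedProblem n k) (x : EuclideanSpace ℝ (Fin n))
    (t : ℝ) : ℝ :=
  deriv (fun s => P.g x s) t

/-- The crossing is transversal: the rate `mᵀ f + μ` at which `g` changes along the trajectory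
vanishes neither just before nor just after the crossing. -/
def IsTransversal {n k : ℕ} (P : SwitchedProblem n k) (x : ℝ → EuclideanSpace ℝ (Fin n))
    (u₁ u₂ : ℝ → EuclideanSpace ℝ (Fin k)) (τ : ℝ) : Prop :=
  inner ℝ (P.normal (x τ) τ) (P.f₁ (x τ) (u₁ τ) τ) + P.timeSlope (x τ) τ ≠ 0 ∧
    inner ℝ (P.normal (x τ) τ) (P.f₂ (x τ) (u₂ τ) τ) + P.timeSlope (x τ) τ ≠ 0

/-- `p₁` on `[t₀, τ]` and `p₂` on `[τ, t_f]` are the two phases of a co-state along the process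
`(x, u₁, u₂, τ)`, with multiplier `ν` for the interface constraint: the adjoint equations, the
stationarity of the Hamiltonian in the control, the transversality condition at the final time,
and the conditions at the crossing. In the problem with the time as additional state, the latter
say that the augmented co-state `(λ, λ_t)` jumps by `-ν (m, μ)` and that the augmented
Hamiltonian `H + λ_t` is continuous; the second one reads `H₂ - H₁ = ν μ`. -/
structure IsCostate {n k : ℕ} (P : SwitchedProblem n k) (x : ℝ → EuclideanSpace ℝ (Fin n))
    (u₁ u₂ : ℝ → EuclideanSpace ℝ (Fin k)) (τ : ℝ)
    (p₁ p₂ : ℝ → EuclideanSpace ℝ (Fin n)) (ν : ℝ) : Prop where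
  adjoint₁ : ∀ t ∈ Set.Icc P.t₀ τ,
    HasDerivWithinAt p₁ (-gradient (fun y => P.H₁ y (p₁ t) (u₁ t) t) (x t)) (Set.Icc P.t₀ τ) t
  adjoint₂ : ∀ t ∈ Set.Icc τ P.t_f,
    HasDerivWithinAt p₂ (-gradient (fun y => P.H₂ y (p₂ t) (u₂ t) t) (x t)) (Set.Icc τ P.t_f) t
  stationary₁ : ∀ t ∈ Set.Icc P.t₀ τ, gradient (fun v => P.H₁ (x t) (p₁ t) v t) (u₁ t) = 0
  stationary₂ : ∀ t ∈ Set.Icc τ P.t_f, gradient (fun v => P.H₂ (x t) (p₂ t) v t) (u₂ t) = 0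
  terminal : p₂ P.t_f - gradient P.φ (x P.t_f) ∈ P.Wᗮ
  jump : p₂ τ - p₁ τ + ν • P.normal (x τ) τ = 0
  hamiltonian : P.H₂ (x τ) (p₂ τ) (u₂ τ) τ - P.H₁ (x τ) (p₁ τ) (u₁ τ) τ
    = ν * P.timeSlope (x τ) τ

/-- The same problem with stage costs and terminal cost replaced by zero. -/
def withoutCost {n k : ℕ} (P : SwitchedProblem n k) : SwitchedProblem n k :=
  { P with L₁ := fun _ _ _ => 0, L₂ := fun _ _ _ => 0, φ := fun _ => 0 }

/-- The process is normal: there is no nonzero abnormal co-state, that is, no nonzero co-state for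
the problem with zero cost. -/
def IsNormal {n k : ℕ} (P : SwitchedProblem n k) (x : ℝ → EuclideanSpace ℝ (Fin n))
    (u₁ u₂ : ℝ → EuclideanSpace ℝ (Fin k)) (τ : ℝ) : Prop :=
  ∀ p₁ p₂ ν, P.withoutCost.IsCostate x u₁ u₂ τ p₁ p₂ ν →
    (∀ t ∈ Set.Icc P.t₀ τ, p₁ t = 0) ∧ (∀ t ∈ Set.Icc τ P.t_f, p₂ t = 0)

/-- The jump law `Δλ = -(ΔL + ⟨λ⟩ᵀ Δf) m / ⟨mᵀ f + μ⟩` at the crossing, where `Δ` is the value in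
mode 2 minus the value in mode 1 and `⟨·⟩` is the mean of both. -/
def JumpLaw {n k : ℕ} (P : SwitchedProblem n k) (x : ℝ → EuclideanSpace ℝ (Fin n))
    (u₁ u₂ : ℝ → EuclideanSpace ℝ (Fin k)) (τ : ℝ)
    (p₁ p₂ : ℝ → EuclideanSpace ℝ (Fin n)) : Prop :=
  let m := P.normal (x τ) τ
  let μ := P.timeSlope (x τ) τ
  let a₁ := P.f₁ (x τ) (u₁ τ) τ
  let a₂ := P.f₂ (x τ) (u₂ τ) τ
  let ΔL := P.L₂ (x τ) (u₂ τ) τ - P.L₁ (x τ) (u₁ τ) τ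
  p₂ τ - p₁ τ =
    -((ΔL + inner ℝ ((1 / 2 : ℝ) • (p₁ τ + p₂ τ)) (a₂ - a₁)) /
      ((1 / 2 : ℝ) * ((inner ℝ m a₁ + μ) + (inner ℝ m a₂ + μ)))) • m

end SwitchedProblem

/-!
Rescaling time so that each phase runs over the unit interval, with the speed as an additional
control, turns the free crossing time into the value of a state and leaves a smooth problem on a
fixed interval. Transversality guarantees that every trajectory close to the given one which
satisfies the end point conditions has no other crossing, so the process yields a local extremum of
a function of the end points of two trajectories.

The Lagrange multiplier rule for this constrained extremum in the space of continuous curves yields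
an adjoint arc in each phase, which is the augmented co-state `(λ, λ_t, c)` for the variables state,
time and accumulated cost. Stationarity in the speed says that `λ_t` is minus the Hamiltonian, and
the multiplier of the condition `g = 0` is the factor `-ν` of `(m, μ)` in the jump of `(λ, λ_t)`.
Normality excludes `c = 0`.

By the product rule `Δ(λᵀf) = ⟨λ⟩ᵀΔf + Δλᵀ⟨f⟩`, the two crossing conditions combine to
`ΔL + ⟨λ⟩ᵀΔf = ν ⟨mᵀf + μ⟩`, which determines `ν`. The mean `⟨mᵀf + μ⟩` is positive since `g`
increases through zero at the crossing.
-/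

open Set Filter Topology MeasureTheory
open scoped unitInterval

section ContinuousMaps

variable {K E F : Type*} [TopologicalSpace K]
  [NormedAddCommGroup E] [NormedSpace ℝ E] [NormedAddCommGroup F] [NormedSpace ℝ F]

/-- The embedding of `E` into the continuous maps as the constant ones. -/
def constCLM (K : Type*) [TopologicalSpace K] : E →L[ℝ] C(K, E) where
  toFun := ContinuousMap.const K
  map_add' _ _ := rfl
  map_smul' _ _ := rfl
  cont := ContinuousMap.continuous_const'

@[simp] theorem constCLM_apply (a : E) (s : K) : constCLM K a s = a := rfl

/-- The derivative of a continuously differentiable map along a continuous map. -/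
noncomputable def fderivAlong {f : E → F} (hf : ContDiff ℝ 1 f) (y : C(K, E)) :
    C(K, E →L[ℝ] F) :=
  ⟨fun s => fderiv ℝ f (y s), (hf.continuous_fderiv one_ne_zero).comp y.continuous⟩

@[simp] theorem fderivAlong_apply {f : E → F} (hf : ContDiff ℝ 1 f) (y : C(K, E)) (s : K) :
    fderivAlong hf y s = fderiv ℝ f (y s) := rfl

theorem exists_forall_norm_fderiv_sub_le_of_isCompact {f : E → F} (hf : ContDiff ℝ 1 f)
    {s : Set E} (hs : IsCompact s) {c : ℝ} (hc : 0 < c) :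
    ∃ δ > 0, ∀ x ∈ s, ∀ y ∈ Metric.ball x δ, ‖fderiv ℝ f y - fderiv ℝ f x‖ ≤ c := by
  have hunif := hs.uniformContinuousAt_of_continuousAt (fderiv ℝ f)
    (fun x _ => (hf.continuous_fderiv one_ne_zero).continuousAt) (Metric.dist_mem_uniformity hc)
  obtain ⟨δ, hδ, hdist⟩ := Metric.mem_uniformity_dist.1 hunif
  refine ⟨δ, hδ, fun x hx y hy => ?_⟩
  rw [← dist_eq_norm, dist_comm]
  exact (hdist (Metric.mem_ball'.1 hy) hx).le

variable [CompactSpace K]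

/-- Pointwise application of a continuous family of operators, as an operator on continuous maps. -/
noncomputable def pointwiseCLM (A : C(K, E →L[ℝ] F)) : C(K, E) →L[ℝ] C(K, F) :=
  LinearMap.mkContinuous
    { toFun := fun y => ⟨fun s => A s (y s), A.continuous.clm_apply y.continuous⟩
      map_add' := fun y z => by ext s; simp
      map_smul' := fun c y => by ext s; simp } ‖A‖ fun y => by
    refine (ContinuousMap.norm_le _ (by positivity)).2 fun s => ?_
    exact (A s).le_of_opNorm_le_of_le (A.norm_coe_le_norm s) (y.norm_coe_le_norm s)

@[simp] theorem pointwiseCLM_apply (A : C(K, E →L[ℝ] F)) (y : C(K, E)) (s : K) :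
    pointwiseCLM A y s = A s (y s) := rfl

theorem hasStrictFDerivAt_comp_continuousMap {f : E → F} (hf : ContDiff ℝ 1 f) (y : C(K, E)) :
    HasStrictFDerivAt (fun z : C(K, E) => (⟨f, hf.continuous⟩ : C(E, F)).comp z)
      (pointwiseCLM (fderivAlong hf y)) y := by
  rw [hasStrictFDerivAt_iff_isLittleO, Asymptotics.isLittleO_iff]
  intro c hc
  obtain ⟨δ, hδ, hfderiv⟩ :=
    exists_forall_norm_fderiv_sub_le_of_isCompact hf (isCompact_range y.continuous) hc
  filter_upwards [Metric.ball_mem_nhds (y, y) hδ] with ⟨z, w⟩ hzw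
  rw [Metric.mem_ball, Prod.dist_eq, max_lt_iff] at hzw
  have mem_ball : ∀ v : C(K, E), dist v y < δ → ∀ s, v s ∈ Metric.ball (y s) δ := fun v hv s =>
    (ContinuousMap.dist_apply_le_dist s).trans_lt hv
  refine (ContinuousMap.norm_le _ (by positivity)).2 fun s => ?_
  have mean_value : ‖f (z s) - f (w s) - fderiv ℝ f (y s) (z s - w s)‖ ≤ c * ‖z s - w s‖ :=
    (convex_ball (y s) δ).norm_image_sub_le_of_norm_hasFDerivWithin_le'
      (fun x _ => (hf.differentiable one_ne_zero x).hasFDerivAt.hasFDerivWithinAt)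
      (hfderiv (y s) (mem_range_self s)) (mem_ball w hzw.2 s) (mem_ball z hzw.1 s)
  exact mean_value.trans (by gcongr; exact (z - w).norm_coe_le_norm s)

end ContinuousMaps

section Primitives

variable {E F : Type*} [NormedAddCommGroup E] [NormedSpace ℝ E]
  [NormedAddCommGroup F] [NormedSpace ℝ F]

/-- `y` is differentiable on the unit interval with derivative `w`, one-sided at the end points. -/
def IsPrimitive (y w : I → E) : Prop :=
  ∀ s : I, HasDerivWithinAt (IccExtend zero_le_one y) (w s) (Icc 0 1) s

namespace IsPrimitive

variable {y w : I → E}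

theorem of_hasDerivWithinAt {f : ℝ → E} (h : ∀ s : I, HasDerivWithinAt f (w s) (Icc 0 1) s) :
    IsPrimitive (fun s => f s) w := fun s =>
  (h s).congr_of_mem (fun _ => IccExtend_of_mem zero_le_one fun s : I => f s) s.2

theorem continuousOn_IccExtend (h : IsPrimitive y w) :
    ContinuousOn (IccExtend zero_le_one y) (Icc 0 1) :=
  fun s hs => (h ⟨s, hs⟩).continuousWithinAt

theorem continuous (h : IsPrimitive y w) : Continuous y := by
  simpa only [Function.comp_def, IccExtend_val] using
    h.continuousOn_IccExtend.comp_continuous continuous_subtype_val Subtype.prop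

theorem hasDerivAt_IccExtend (h : IsPrimitive y w) {s : ℝ} (hs : s ∈ Ioo (0 : ℝ) 1) :
    HasDerivAt (IccExtend zero_le_one y) (w ⟨s, Ioo_subset_Icc_self hs⟩) s :=
  (h ⟨s, Ioo_subset_Icc_self hs⟩).hasDerivAt (Icc_mem_nhds hs.1 hs.2)

theorem fderiv_comp {f : E → F} {f' : I → E →L[ℝ] F} (hf : ∀ s, HasFDerivAt f (f' s) (y s))
    (h : IsPrimitive y w) : IsPrimitive (fun s => f (y s)) (fun s => f' s (w s)) := fun s => by
  have hfs : HasFDerivAt f (f' s) (IccExtend zero_le_one y s) := by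
    simpa only [IccExtend_val] using hf s
  exact hfs.comp_hasDerivWithinAt (s : ℝ) (h s)

theorem clm_comp (T : E →L[ℝ] F) (h : IsPrimitive y w) :
    IsPrimitive (fun s => T (y s)) (fun s => T (w s)) :=
  h.fderiv_comp fun _ => T.hasFDerivAt

theorem prodMk {z v : I → F} (h : IsPrimitive y w) (hz : IsPrimitive z v) :
    IsPrimitive (fun s => (y s, z s)) fun s => (w s, v s) := fun s =>
  (h s).prodMk (hz s)

theorem clm_apply {A A' : I → E →L[ℝ] F} (hA : IsPrimitive A A') (h : IsPrimitive y w) :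
    IsPrimitive (fun s => A s (y s)) (fun s => A' s (y s) + A s (w s)) := fun s => by
  have := (hA s).clm_apply (h s)
  rwa [IccExtend_val, IccExtend_val] at this

theorem reverse (h : IsPrimitive y w) :
    IsPrimitive (fun s => y (σ s)) (fun s => -w (σ s)) := by
  have hderiv : ∀ s : I, HasDerivWithinAt (fun r => IccExtend zero_le_one y (1 - r))
      (-w (σ s)) (Icc 0 1) s := fun s => by
    have hmaps : MapsTo (fun r : ℝ => 1 - r) (Icc 0 1) (Icc 0 1) := fun r hr =>
      ⟨by linarith [hr.2], by linarith [hr.1]⟩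
    simpa [Function.comp_def] using (h (σ s)).scomp (s : ℝ)
      ((hasDerivAt_id (s : ℝ)).const_sub 1).hasDerivWithinAt hmaps
  have hval : ∀ s : I, IccExtend zero_le_one y (1 - s) = y (σ s) := fun s =>
    IccExtend_val zero_le_one y (σ s)
  simpa only [hval] using of_hasDerivWithinAt hderiv

theorem integral_eq_sub [CompleteSpace E] (h : IsPrimitive y w) (hw : Continuous w) (s : I) :
    ∫ r in (0 : ℝ)..s, IccExtend zero_le_one w r = y s - y 0 := by
  have ftc := intervalIntegral.integral_eq_sub_of_hasDerivAt_of_le s.2.1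
    (f' := IccExtend zero_le_one w)
    (h.continuousOn_IccExtend.mono (Icc_subset_Icc_right s.2.2))
    (fun r hr => by
      have hr01 : r ∈ Ioo (0 : ℝ) 1 := Ioo_subset_Ioo_right s.2.2 hr
      rw [IccExtend_of_mem _ _ (Ioo_subset_Icc_self hr01)]
      exact h.hasDerivAt_IccExtend hr01)
    (hw.Icc_extend'.intervalIntegrable _ _)
  rwa [IccExtend_val, IccExtend_left] at ftc

theorem eq_apply_zero [CompleteSpace E] (h : IsPrimitive y 0) (s : I) : y s = y 0 := by
  have := h.integral_eq_sub continuous_const s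
  rw [← sub_eq_zero, ← this]
  exact intervalIntegral.integral_zero

theorem strictMonoOn_Ici {y w : I → ℝ} {a : I} (h : IsPrimitive y w) (hw : ∀ s ≥ a, 0 < w s) :
    StrictMonoOn y (Ici a) := by
  have hmono : StrictMonoOn (IccExtend zero_le_one y) (Icc a 1) := by
    refine strictMonoOn_of_deriv_pos (convex_Icc (a : ℝ) 1)
      (h.continuousOn_IccExtend.mono (Icc_subset_Icc_left a.2.1)) fun s hs => ?_
    rw [interior_Icc] at hs
    rw [(h.hasDerivAt_IccExtend ⟨a.2.1.trans_lt hs.1, hs.2⟩).deriv]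
    exact hw _ hs.1.le
  intro r hr s hs hrs
  simpa only [IccExtend_val] using hmono ⟨hr, r.2.2⟩ ⟨hs, s.2.2⟩ hrs

theorem strictMono {y w : I → ℝ} (h : IsPrimitive y w) (hw : ∀ s, 0 < w s) : StrictMono y :=
  fun r s hrs => h.strictMonoOn_Ici (a := 0) (fun s _ => hw s) r.2.1 s.2.1 hrs

theorem eq_zero_of_nonneg {y w : I → ℝ} (h : IsPrimitive y w) (hw : Continuous w)
    (hw0 : ∀ s, 0 ≤ w s) (hy : y 1 = y 0) (s : I) : w s = 0 := by
  by_contra hne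
  have hpos := intervalIntegral.integral_pos one_pos hw.Icc_extend'.continuousOn
    (fun r _ => hw0 (projIcc 0 1 zero_le_one r))
    ⟨s, s.2, by rw [IccExtend_val]; exact (hw0 s).lt_of_ne' hne⟩
  have hint := h.integral_eq_sub hw 1
  rw [hy, sub_self] at hint
  exact hpos.ne' hint

end IsPrimitive

/-- The Volterra operator `w ↦ ∫₀ˢ w`. -/
noncomputable def volterra : C(I, E) →L[ℝ] C(I, E) :=
  LinearMap.mkContinuous
    { toFun := fun w => ⟨fun s => ∫ r in (0 : ℝ)..s, IccExtend zero_le_one w r,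
        (intervalIntegral.continuous_primitive
          (fun a b => w.continuous.Icc_extend'.intervalIntegrable a b) 0).comp
          continuous_subtype_val⟩
      map_add' := fun w z => by
        ext s
        exact intervalIntegral.integral_add (w.continuous.Icc_extend'.intervalIntegrable _ _)
          (z.continuous.Icc_extend'.intervalIntegrable _ _)
      map_smul' := fun c w => by
        ext s
        exact intervalIntegral.integral_smul c (IccExtend zero_le_one w) } 1 fun w => by
    refine (ContinuousMap.norm_le _ (by positivity)).2 fun s => ?_
    refine (intervalIntegral.norm_integral_le_of_norm_le_const (C := ‖w‖)
      fun r _ => w.norm_coe_le_norm _).trans ?_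
    rw [sub_zero, abs_of_nonneg s.2.1, one_mul]
    exact mul_le_of_le_one_right (norm_nonneg _) s.2.2

theorem volterra_apply (w : C(I, E)) (s : I) :
    volterra w s = ∫ r in (0 : ℝ)..s, IccExtend zero_le_one w r := rfl

@[simp] theorem volterra_apply_zero (w : C(I, E)) : volterra w 0 = 0 :=
  intervalIntegral.integral_same

theorem isPrimitive_const_add_volterra [CompleteSpace E] (a : E) (w : C(I, E)) :
    IsPrimitive (constCLM I a + volterra w) w :=
  .of_hasDerivWithinAt (f := fun s => a + ∫ r in (0 : ℝ)..s, IccExtend zero_le_one w r)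
    fun s => by
      rw [← IccExtend_val zero_le_one w s]
      exact ((w.continuous.Icc_extend'.integral_hasStrictDerivAt 0 s).hasDerivAt.const_add
        a).hasDerivWithinAt

theorem isPrimitive_iff_eq_const_add_volterra [CompleteSpace E] {y w : C(I, E)} :
    IsPrimitive y w ↔ y = constCLM I (y 0) + volterra w := by
  refine ⟨fun h => ?_, fun h => h ▸ isPrimitive_const_add_volterra (y 0) w⟩
  ext s
  simp [volterra_apply, h.integral_eq_sub w.continuous s]

theorem norm_volterra_apply_le {w : C(I, E)} {C : ℝ} {n : ℕ}
    (h : ∀ s : I, ‖w s‖ ≤ C * (s : ℝ) ^ n) (s : I) :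
    ‖volterra w s‖ ≤ C * ((s : ℝ) ^ (n + 1) / (n + 1)) := by
  calc ‖volterra w s‖ ≤ ∫ r in (0 : ℝ)..s, C * r ^ n := by
        refine intervalIntegral.norm_integral_le_of_norm_le s.2.1 (ae_of_all _ fun r hr => ?_)
          ((by fun_prop : Continuous fun r : ℝ => C * r ^ n).intervalIntegrable _ _)
        have hr01 : r ∈ Icc (0 : ℝ) 1 := ⟨hr.1.le, hr.2.trans s.2.2⟩
        rw [IccExtend_of_mem _ _ hr01]
        exact h ⟨r, hr01⟩
    _ = C * ((s : ℝ) ^ (n + 1) / (n + 1)) := by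
        simp [intervalIntegral.integral_const_mul, integral_pow]

theorem norm_volterra_pointwise_pow_apply_le (A : C(I, E →L[ℝ] E)) (y : C(I, E)) (n : ℕ) (s : I) :
    ‖((volterra ∘L pointwiseCLM A) ^ n) y s‖ ≤ ‖A‖ ^ n / n.factorial * ‖y‖ * (s : ℝ) ^ n := by
  induction n generalizing s with
  | zero => simpa using y.norm_coe_le_norm s
  | succ n ih =>
    have hpoint : ∀ s : I, ‖pointwiseCLM A (((volterra ∘L pointwiseCLM A) ^ n) y) s‖
        ≤ ‖A‖ * (‖A‖ ^ n / n.factorial * ‖y‖) * (s : ℝ) ^ n := fun s => by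
      rw [mul_assoc]
      exact (A s).le_of_opNorm_le_of_le (A.norm_coe_le_norm s) (ih s)
    rw [pow_succ']
    refine (norm_volterra_apply_le hpoint s).trans_eq ?_
    rw [Nat.factorial_succ]
    push_cast
    field_simp
    ring

theorem exists_norm_volterra_pointwise_pow_lt_one (A : C(I, E →L[ℝ] E)) :
    ∃ n : ℕ, ‖(volterra ∘L pointwiseCLM A) ^ n‖ < 1 := by
  obtain ⟨n, hn⟩ : ∃ n : ℕ, ‖A‖ ^ n / n.factorial < 1 :=
    ((FloorSemiring.tendsto_pow_div_factorial_atTop ‖A‖).eventually (gt_mem_nhds one_pos)).exists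
  refine ⟨n, (ContinuousLinearMap.opNorm_le_bound _ (by positivity) fun y => ?_).trans_lt hn⟩
  refine (ContinuousMap.norm_le _ (by positivity)).2 fun s => ?_
  exact (norm_volterra_pointwise_pow_apply_le A y n s).trans
    (mul_le_of_le_one_right (by positivity) (pow_le_one₀ s.2.1 s.2.2))

theorem isUnit_one_sub_of_norm_pow_lt_one {R : Type*} [NormedRing R] [HasSummableGeomSeries R]
    {x : R} {n : ℕ} (h : ‖x ^ n‖ < 1) : IsUnit (1 - x) := by
  have hunit := isUnit_one_sub_of_norm_lt_one h
  rw [← mul_neg_geom_sum] at hunit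
  exact ((Commute.isUnit_mul_iff
    ((Commute.one_left _).sub_left (Commute.sum_right _ _ _ fun i _ =>
      (Commute.refl x).pow_right i))).1 hunit).1

variable [CompleteSpace E]

theorem exists_eq_add_volterra_pointwise (A : C(I, E →L[ℝ] E)) (a : C(I, E)) :
    ∃ y : C(I, E), y = a + volterra (pointwiseCLM A y) := by
  obtain ⟨n, hn⟩ := exists_norm_volterra_pointwise_pow_lt_one A
  obtain ⟨R, hR⟩ := (isUnit_one_sub_of_norm_pow_lt_one
    (R := C(I, E) →L[ℝ] C(I, E)) hn).exists_right_inv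
  exact ⟨R a, sub_eq_iff_eq_add.1 (DFunLike.congr_fun hR a)⟩

theorem exists_isPrimitive_of_apply_one (A : C(I, E →L[ℝ] E)) (b : E) :
    ∃ y : C(I, E), y 1 = b ∧ IsPrimitive y fun s => A s (y s) := by
  let symm : C(I, I) := ⟨σ, unitInterval.continuous_symm⟩
  obtain ⟨z, hz⟩ := exists_eq_add_volterra_pointwise (-A.comp symm) (constCLM I b)
  have hz0 : z 0 = b := by rw [hz]; simp
  have hprim : IsPrimitive z (pointwiseCLM (-A.comp symm) z) := by
    rw [isPrimitive_iff_eq_const_add_volterra, hz0]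
    exact hz
  have hrev : IsPrimitive (fun s => z (σ s)) fun s => A s (z (σ s)) := by
    simpa [symm] using hprim.reverse
  exact ⟨z.comp symm, by simp [symm, hz0], hrev⟩

end Primitives

section LagrangeMultipliers

variable {X G Y : Type*} [NormedAddCommGroup X] [NormedSpace ℝ X]
  [NormedAddCommGroup G] [NormedSpace ℝ G] [CompleteSpace G]
  [NormedAddCommGroup Y] [NormedSpace ℝ Y] [FiniteDimensional ℝ Y]

theorem range_prod_eq_top_of_map_ker_eq_top {R V₁ V₂ V₃ : Type*} [Ring R]
    [AddCommGroup V₁] [Module R V₁] [AddCommGroup V₂] [Module R V₂]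
    [AddCommGroup V₃] [Module R V₃] {f : V₁ →ₗ[R] V₂} {g : V₁ →ₗ[R] V₃} (hf : Function.Surjective f)
    (hg : (LinearMap.ker f).map g = ⊤) : LinearMap.range (f.prod g) = ⊤ := by
  rw [eq_top_iff]
  rintro ⟨a, b⟩ -
  obtain ⟨x, rfl⟩ := hf a
  obtain ⟨y, hy, hgy⟩ : b - g x ∈ (LinearMap.ker f).map g := hg ▸ Submodule.mem_top
  refine ⟨x + y, ?_⟩
  simp [LinearMap.mem_ker.1 hy, hgy]

theorem exists_multiplier_of_map_ker_ne_top {V : Submodule ℝ X}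
    {g' : X →L[ℝ] Y} {φ' : X →L[ℝ] ℝ} (hV : V.map (g'.prod φ').toLinearMap ≠ ⊤) :
    ∃ (Λ : Y →L[ℝ] ℝ) (c : ℝ), (c = 1 ∨ c = 0 ∧ Λ ≠ 0) ∧ ∀ x ∈ V, Λ (g' x) + c * φ' x = 0 := by
  obtain ⟨ℓ, hℓ, hVℓ⟩ := Submodule.exists_le_ker_of_lt_top _ (lt_top_iff_ne_top.2 hV)
  set Λ : Y →L[ℝ] ℝ := (ℓ ∘ₗ LinearMap.inl ℝ Y ℝ).toContinuousLinearMap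
  set c : ℝ := ℓ (0, 1)
  have split : ∀ p : Y × ℝ, ℓ p = Λ p.1 + c * p.2 := fun p => by
    calc ℓ p = ℓ ((p.1, 0) + p.2 • (0, 1)) := by simp
      _ = Λ p.1 + c * p.2 := by rw [map_add, map_smul, smul_eq_mul, mul_comm]; rfl
  have annihilates : ∀ x ∈ V, Λ (g' x) + c * φ' x = 0 := fun x hx => by
    rw [← split (g' x, φ' x)]
    exact hVℓ ⟨x, hx, rfl⟩
  by_cases hc0 : c = 0
  · refine ⟨Λ, c, .inr ⟨hc0, fun hΛ0 => hℓ (LinearMap.ext fun p => ?_)⟩, annihilates⟩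
    simp [split p, hΛ0, hc0]
  · refine ⟨c⁻¹ • Λ, 1, .inl rfl, fun x hx => ?_⟩
    simpa [mul_add, hc0] using congrArg (c⁻¹ * ·) (annihilates x hx)

theorem exists_multiplier_of_isLocalExtrOn [CompleteSpace X]
    {f : X → G} {g : X → Y} {φ : X → ℝ} {x₀ : X}
    {f' : X →L[ℝ] G} {g' : X →L[ℝ] Y} {φ' : X →L[ℝ] ℝ}
    (hextr : IsLocalExtrOn φ {x | f x = f x₀ ∧ g x = g x₀} x₀)
    (hf : HasStrictFDerivAt f f' x₀) (hg : HasStrictFDerivAt g g' x₀)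
    (hφ : HasStrictFDerivAt φ φ' x₀) (hsurj : Function.Surjective f') :
    ∃ (Λ : Y →L[ℝ] ℝ) (c : ℝ), (c = 1 ∨ c = 0 ∧ Λ ≠ 0) ∧
      ∀ x, f' x = 0 → Λ (g' x) + c * φ' x = 0 := by
  have : CompleteSpace Y := FiniteDimensional.complete ℝ Y
  have hextr' : IsLocalExtrOn φ {x | (f x, g x) = (f x₀, g x₀)} x₀ := by
    simpa only [Prod.mk.injEq] using hextr
  have hker : (LinearMap.ker f'.toLinearMap).map (g'.prod φ').toLinearMap ≠ ⊤ := by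
    intro htop
    refine hextr'.range_ne_top_of_hasStrictFDerivAt (hf.prodMk hg) hφ ?_
    rw [eq_top_iff]
    rintro ⟨⟨a, b⟩, r⟩ -
    obtain ⟨x, hx⟩ : (a, b, r) ∈ LinearMap.range (f'.toLinearMap.prod (g'.prod φ').toLinearMap) :=
      range_prod_eq_top_of_map_ker_eq_top hsurj htop ▸ Submodule.mem_top
    exact ⟨x, by simp_all⟩
  exact exists_multiplier_of_map_ker_ne_top hker

end LagrangeMultipliers

section AdjointArcs

variable {Z U : Type*} [NormedAddCommGroup Z] [NormedSpace ℝ Z]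
  [NormedAddCommGroup U] [NormedSpace ℝ U]

/-- The states of a curve of states and controls at the times `0` and `1`. -/
noncomputable def endpointsCLM : C(I, Z × U) →L[ℝ] Z × Z :=
  ((ContinuousLinearMap.fst ℝ Z U) ∘L ContinuousMap.evalCLM ℝ (0 : I)).prod
    ((ContinuousLinearMap.fst ℝ Z U) ∘L ContinuousMap.evalCLM ℝ (1 : I))

@[simp] theorem endpointsCLM_apply (γ : C(I, Z × U)) :
    endpointsCLM γ = ((γ 0).1, (γ 1).1) := rfl

/-- `δ` is a trajectory of the linear control system `z' = D (z, u)`, where `D` depends on time. -/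
def IsLinearTrajectory (D : C(I, Z × U →L[ℝ] Z)) (δ : C(I, Z × U)) : Prop :=
  IsPrimitive (fun s => (δ s).1) fun s => D s (δ s)

theorem isLinearTrajectory_zero (D : C(I, Z × U →L[ℝ] Z)) : IsLinearTrajectory D 0 :=
  .of_hasDerivWithinAt (f := fun _ => 0) fun s => by
    simpa using hasDerivWithinAt_const (s : ℝ) (Icc 0 1) (0 : Z)

/-- `q` is an adjoint arc of the linear control system `z' = D (z, u)`: it solves the adjoint
equation `q' = -q ∂D/∂z`, annihilates `∂D/∂u`, and its boundary values are those prescribed by the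
functional `b` of the two end points. -/
structure IsAdjointArc (D : C(I, Z × U →L[ℝ] Z)) (b : Z × Z →L[ℝ] ℝ) (q : I → Z →L[ℝ] ℝ) :
    Prop where
  adjoint : IsPrimitive q fun s => -(q s ∘L D s ∘L .inl ℝ Z U)
  stationary : ∀ s, q s ∘L D s ∘L .inr ℝ Z U = 0
  apply_zero : q 0 = -(b ∘L .inl ℝ Z Z)
  apply_one : q 1 = b ∘L .inr ℝ Z Z

/-- The defect `y - a - ∫₀ˢ w` of the initial value problem `y' = w`, `y 0 = a`, as an operator on
triples `(a, y, w)`. -/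
noncomputable def primitiveDefect : Z × C(I, Z) × C(I, Z) →L[ℝ] C(I, Z) :=
  (ContinuousLinearMap.fst ℝ _ _ - volterra ∘L ContinuousLinearMap.snd ℝ _ _) ∘L
    ContinuousLinearMap.snd ℝ _ _ - constCLM I ∘L ContinuousLinearMap.fst ℝ _ _

@[simp] theorem primitiveDefect_apply (p : Z × C(I, Z) × C(I, Z)) :
    primitiveDefect p = p.2.1 - volterra p.2.2 - constCLM I p.1 := rfl

variable {D : C(I, Z × U →L[ℝ] Z)}

theorem exists_adjoint_of_apply_one (D : C(I, Z × U →L[ℝ] Z)) (b : Z →L[ℝ] ℝ) :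
    ∃ q : C(I, Z →L[ℝ] ℝ), q 1 = b ∧ IsPrimitive q fun s => -(q s ∘L D s ∘L .inl ℝ Z U) :=
  exists_isPrimitive_of_apply_one
    ⟨fun s => -(ContinuousLinearMap.compL ℝ Z Z ℝ).flip (D s ∘L .inl ℝ Z U), by fun_prop⟩ b

theorem IsLinearTrajectory.isPrimitive_adjoint_apply {δ : C(I, Z × U)}
    (hδ : IsLinearTrajectory D δ) {q : I → Z →L[ℝ] ℝ}
    (hq : IsPrimitive q fun s => -(q s ∘L D s ∘L .inl ℝ Z U)) :
    IsPrimitive (fun s => q s (δ s).1) fun s => q s (D s (0, (δ s).2)) := by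
  have split : ∀ s, D s (δ s) = D s ((δ s).1, 0) + D s (0, (δ s).2) := fun s => by
    simp [← map_add]
  simpa [split] using hq.clm_apply hδ

variable [CompleteSpace Z]

theorem primitiveDefect_eq_zero_iff {a : Z} {y w : C(I, Z)} :
    primitiveDefect (a, y, w) = 0 ↔ y 0 = a ∧ IsPrimitive y w := by
  have hdefect : primitiveDefect (a, y, w) = 0 ↔ y = constCLM I a + volterra w := by
    rw [primitiveDefect_apply, sub_sub, sub_eq_zero, add_comm]
  rw [hdefect]
  constructor
  · intro h
    have hy0 : y 0 = a := by rw [h]; simp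
    exact ⟨hy0, isPrimitive_iff_eq_const_add_volterra.2 (hy0.symm ▸ h)⟩
  · rintro ⟨rfl, h⟩
    exact isPrimitive_iff_eq_const_add_volterra.1 h

theorem exists_primitiveDefect_linear_eq (D : C(I, Z × U →L[ℝ] Z)) (a : Z) (v : C(I, U))
    (w : C(I, Z)) :
    ∃ y : C(I, Z), primitiveDefect (a, y, pointwiseCLM D (y.prodMk v)) = w := by
  let A : C(I, Z →L[ℝ] Z) := ⟨fun s => D s ∘L .inl ℝ Z U, by fun_prop⟩
  let forcing : C(I, Z) := ⟨fun s => D s (0, v s), by fun_prop⟩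
  obtain ⟨y, hy⟩ := exists_eq_add_volterra_pointwise A (w + constCLM I a + volterra forcing)
  have hD : pointwiseCLM D (y.prodMk v) = forcing + pointwiseCLM A y := by
    ext s
    simp [forcing, A, ← map_add]
  refine ⟨y, ?_⟩
  rw [primitiveDefect_apply, hD, map_add, sub_sub, sub_eq_iff_eq_add]
  refine hy.trans ?_
  abel

theorem exists_isLinearTrajectory (D : C(I, Z × U →L[ℝ] Z)) (a : Z) (v : C(I, U)) :
    ∃ δ : C(I, Z × U), IsLinearTrajectory D δ ∧ (δ 0).1 = a ∧ ∀ s, (δ s).2 = v s := by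
  obtain ⟨y, hy⟩ := exists_primitiveDefect_linear_eq D a v 0
  obtain ⟨hy0, hprim⟩ := primitiveDefect_eq_zero_iff.1 hy
  exact ⟨y.prodMk v, hprim, hy0, fun _ => rfl⟩

/- Du Bois-Reymond: the control `v = (q D (0, u)) u` makes the integrand of the boundary term the
square of `q D (0, u)`. -/
theorem stationary_of_forall_isLinearTrajectory {q : C(I, Z →L[ℝ] ℝ)}
    (hq : IsPrimitive q fun s => -(q s ∘L D s ∘L .inl ℝ Z U))
    (hboundary : ∀ δ, IsLinearTrajectory D δ → (δ 0).1 = 0 → q 1 (δ 1).1 = 0) (s : I) :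
    q s ∘L D s ∘L .inr ℝ Z U = 0 := by
  ext u
  let ρ : C(I, ℝ) := ⟨fun s => q s (D s (0, u)), by fun_prop⟩
  obtain ⟨δ, hδ, hδ0, hδu⟩ := exists_isLinearTrajectory D 0 ⟨fun s => ρ s • u, by fun_prop⟩
  have integrand : ∀ s, q s (D s (0, (δ s).2)) = ρ s * ρ s := fun s => by
    have : ((0 : Z), (δ s).2) = ρ s • (0, u) := by simp [hδu]
    rw [this, map_smul, map_smul]
    rfl
  have hsq : IsPrimitive (fun s => q s (δ s).1) fun s => ρ s * ρ s := by
    simpa only [integrand] using hδ.isPrimitive_adjoint_apply hq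
  have hends : q 1 (δ 1).1 = q 0 (δ 0).1 := by rw [hboundary δ hδ hδ0, hδ0, map_zero]
  exact mul_self_eq_zero.1
    (hsq.eq_zero_of_nonneg (by fun_prop) (fun s => mul_self_nonneg _) hends s)

theorem exists_isAdjointArc {b : Z × Z →L[ℝ] ℝ}
    (hb : ∀ δ, IsLinearTrajectory D δ → b (endpointsCLM δ) = 0) : ∃ q, IsAdjointArc D b q := by
  obtain ⟨q, hq1, hq⟩ := exists_adjoint_of_apply_one D (b ∘L .inr ℝ Z Z)
  have boundary : ∀ δ, IsLinearTrajectory D δ → b ((δ 0).1, 0) + q 1 (δ 1).1 = 0 := fun δ hδ => by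
    rw [hq1, ← hb δ hδ]
    simp [← map_add]
  have initial : ∀ a, b (a, 0) + q 0 a = 0 := fun a => by
    obtain ⟨δ, hδ, rfl, hδu⟩ := exists_isLinearTrajectory D a 0
    have hconst : q 1 (δ 1).1 = q 0 (δ 0).1 := by
      refine IsPrimitive.eq_apply_zero (y := fun s => q s (δ s).1) ?_ 1
      have hzero : (fun s => q s (D s (0, (δ s).2))) = 0 := funext fun s => by
        rw [hδu, ContinuousMap.zero_apply, Prod.mk_zero_zero, map_zero, map_zero, Pi.zero_apply]
      exact hzero ▸ hδ.isPrimitive_adjoint_apply hq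
    rw [← hconst, boundary δ hδ]
  refine ⟨q, hq, stationary_of_forall_isLinearTrajectory hq fun δ hδ hδ0 => ?_, ?_, hq1⟩
  · simpa only [hδ0, Prod.mk_zero_zero, map_zero, zero_add] using boundary δ hδ
  · ext a
    exact eq_neg_of_add_eq_zero_right (initial a)

end AdjointArcs

section Mayer

variable {Z U : Type*} [NormedAddCommGroup Z] [NormedSpace ℝ Z]
  [NormedAddCommGroup U] [NormedSpace ℝ U] {F : Z × U → Z}

/-- `γ` is a trajectory of the control system `z' = F (z, u)` on the unit interval. -/
def IsTrajectory (F : Z × U → Z) (γ : C(I, Z × U)) : Prop :=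
  IsPrimitive (fun s => (γ s).1) fun s => F (γ s)

/-- The equations `z 0 = a`, `z' = F (z, u)`, on pairs of an initial value `a` and a curve `(z, u)`.
The initial value is a separate unknown, which makes the linearization surjective. -/
noncomputable def trajectoryDefect (hF : ContDiff ℝ 1 F) (p : Z × C(I, Z × U)) : C(I, Z) :=
  primitiveDefect (p.1, ContinuousMap.comp .fst p.2, ContinuousMap.comp ⟨F, hF.continuous⟩ p.2)

/-- The derivative of `trajectoryDefect`, for the linearization `D` of `F`. -/
noncomputable def trajectoryDefectCLM (D : C(I, Z × U →L[ℝ] Z)) : Z × C(I, Z × U) →L[ℝ] C(I, Z) :=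
  primitiveDefect ∘L (ContinuousLinearMap.fst ℝ _ _).prod
    ((((ContinuousLinearMap.fst ℝ Z U).compLeftContinuous ℝ I).prod (pointwiseCLM D)) ∘L
      ContinuousLinearMap.snd ℝ _ _)

theorem hasStrictFDerivAt_trajectoryDefect (hF : ContDiff ℝ 1 F) (p : Z × C(I, Z × U)) :
    HasStrictFDerivAt (trajectoryDefect hF) (trajectoryDefectCLM (fderivAlong hF p.2)) p :=
  primitiveDefect.hasStrictFDerivAt.comp p <| hasStrictFDerivAt_fst.prodMk <|
    (((ContinuousLinearMap.fst ℝ Z U).compLeftContinuous ℝ I).hasStrictFDerivAt.prodMk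
      (hasStrictFDerivAt_comp_continuousMap hF p.2)).comp p hasStrictFDerivAt_snd

variable [CompleteSpace Z]

theorem trajectoryDefect_eq_zero_iff (hF : ContDiff ℝ 1 F) {p : Z × C(I, Z × U)} :
    trajectoryDefect hF p = 0 ↔ (p.2 0).1 = p.1 ∧ IsTrajectory F p.2 :=
  primitiveDefect_eq_zero_iff

theorem surjective_trajectoryDefectCLM (D : C(I, Z × U →L[ℝ] Z)) :
    Function.Surjective (trajectoryDefectCLM D) := fun w => by
  obtain ⟨y, hy⟩ := exists_primitiveDefect_linear_eq D 0 0 w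
  exact ⟨(0, y.prodMk 0), hy⟩

theorem IsLinearTrajectory.trajectoryDefectCLM_eq_zero {D : C(I, Z × U →L[ℝ] Z)}
    {δ : C(I, Z × U)} (hδ : IsLinearTrajectory D δ) : trajectoryDefectCLM D ((δ 0).1, δ) = 0 :=
  primitiveDefect_eq_zero_iff.2 ⟨rfl, hδ⟩

end Mayer

section TwoPhaseMayer

variable {Z₁ U₁ Z₂ U₂ Y : Type*}
  [NormedAddCommGroup Z₁] [NormedSpace ℝ Z₁] [CompleteSpace Z₁]
  [NormedAddCommGroup U₁] [NormedSpace ℝ U₁] [CompleteSpace U₁]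
  [NormedAddCommGroup Z₂] [NormedSpace ℝ Z₂] [CompleteSpace Z₂]
  [NormedAddCommGroup U₂] [NormedSpace ℝ U₂] [CompleteSpace U₂]
  [NormedAddCommGroup Y] [NormedSpace ℝ Y] [FiniteDimensional ℝ Y]

/-- The end points of both phases. -/
noncomputable def twoPhaseEndpointsCLM :
    C(I, Z₁ × U₁) × C(I, Z₂ × U₂) →L[ℝ] (Z₁ × Z₁) × Z₂ × Z₂ :=
  endpointsCLM.prodMap endpointsCLM

theorem exists_multiplier_of_isLocalExtrOn_trajectories {F₁ : Z₁ × U₁ → Z₁} {F₂ : Z₂ × U₂ → Z₂}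
    (hF₁ : ContDiff ℝ 1 F₁) (hF₂ : ContDiff ℝ 1 F₂)
    {Ψ : (Z₁ × Z₁) × Z₂ × Z₂ → Y} {Ψ' : (Z₁ × Z₁) × Z₂ × Z₂ →L[ℝ] Y}
    {Φ : (Z₁ × Z₁) × Z₂ × Z₂ → ℝ} {Φ' : (Z₁ × Z₁) × Z₂ × Z₂ →L[ℝ] ℝ}
    {γ : C(I, Z₁ × U₁) × C(I, Z₂ × U₂)}
    (hγ₁ : IsTrajectory F₁ γ.1) (hγ₂ : IsTrajectory F₂ γ.2)
    (hΨ : HasStrictFDerivAt Ψ Ψ' (twoPhaseEndpointsCLM γ))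
    (hΦ : HasStrictFDerivAt Φ Φ' (twoPhaseEndpointsCLM γ))
    (hextr : IsLocalExtrOn (Φ ∘ twoPhaseEndpointsCLM)
      {η | (IsTrajectory F₁ η.1 ∧ IsTrajectory F₂ η.2) ∧
        Ψ (twoPhaseEndpointsCLM η) = Ψ (twoPhaseEndpointsCLM γ)} γ) :
    ∃ (Λ : Y →L[ℝ] ℝ) (c : ℝ), (c = 1 ∨ c = 0 ∧ Λ ≠ 0) ∧
      ∀ δ₁ δ₂, IsLinearTrajectory (fderivAlong hF₁ γ.1) δ₁ →
        IsLinearTrajectory (fderivAlong hF₂ γ.2) δ₂ →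
        (Λ ∘L Ψ' + c • Φ') (twoPhaseEndpointsCLM (δ₁, δ₂)) = 0 := by
  let X := (Z₁ × C(I, Z₁ × U₁)) × Z₂ × C(I, Z₂ × U₂)
  let curves : X →L[ℝ] C(I, Z₁ × U₁) × C(I, Z₂ × U₂) :=
    (ContinuousLinearMap.snd ℝ _ _).prodMap (ContinuousLinearMap.snd ℝ _ _)
  let defect : X → C(I, Z₁) × C(I, Z₂) :=
    Prod.map (trajectoryDefect hF₁) (trajectoryDefect hF₂)
  let p₀ : X := (((γ.1 0).1, γ.1), (γ.2 0).1, γ.2)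
  have hzero : defect p₀ = 0 := Prod.ext ((trajectoryDefect_eq_zero_iff hF₁).2 ⟨rfl, hγ₁⟩)
    ((trajectoryDefect_eq_zero_iff hF₂).2 ⟨rfl, hγ₂⟩)
  have hdefect : HasStrictFDerivAt defect
      ((trajectoryDefectCLM (fderivAlong hF₁ γ.1)).prodMap
        (trajectoryDefectCLM (fderivAlong hF₂ γ.2))) p₀ :=
    (hasStrictFDerivAt_trajectoryDefect hF₁ p₀.1).prodMap p₀
      (hasStrictFDerivAt_trajectoryDefect hF₂ p₀.2)
  have hsurj : Function.Surjective ((trajectoryDefectCLM (fderivAlong hF₁ γ.1)).prodMap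
      (trajectoryDefectCLM (fderivAlong hF₂ γ.2))) :=
    (surjective_trajectoryDefectCLM _).prodMap (surjective_trajectoryDefectCLM _)
  have hends : HasStrictFDerivAt (fun p => twoPhaseEndpointsCLM (curves p))
      (twoPhaseEndpointsCLM ∘L curves) p₀ :=
    (twoPhaseEndpointsCLM ∘L curves).hasStrictFDerivAt
  have hextr' : IsLocalExtrOn (fun p => Φ (twoPhaseEndpointsCLM (curves p)))
      {p | defect p = defect p₀ ∧
        Ψ (twoPhaseEndpointsCLM (curves p)) = Ψ (twoPhaseEndpointsCLM (curves p₀))} p₀ := by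
    refine IsExtrFilter.comp_tendsto (g := curves) (b := p₀) hextr
      (curves.continuous.continuousWithinAt.tendsto_nhdsWithin ?_)
    rintro p ⟨hp, hΨp⟩
    rw [hzero, Prod.ext_iff] at hp
    exact ⟨⟨((trajectoryDefect_eq_zero_iff hF₁).1 hp.1).2,
      ((trajectoryDefect_eq_zero_iff hF₂).1 hp.2).2⟩, hΨp⟩
  obtain ⟨Λ, c, hΛc, hker⟩ := exists_multiplier_of_isLocalExtrOn hextr' hdefect
    (HasStrictFDerivAt.comp (f := fun p => twoPhaseEndpointsCLM (curves p)) p₀ hΨ hends)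
    (HasStrictFDerivAt.comp (f := fun p => twoPhaseEndpointsCLM (curves p)) p₀ hΦ hends) hsurj
  exact ⟨Λ, c, hΛc, fun δ₁ δ₂ hδ₁ hδ₂ => hker (((δ₁ 0).1, δ₁), (δ₂ 0).1, δ₂)
    (Prod.ext hδ₁.trajectoryDefectCLM_eq_zero hδ₂.trajectoryDefectCLM_eq_zero)⟩

theorem exists_isAdjointArc_of_isLocalExtrOn {F₁ : Z₁ × U₁ → Z₁} {F₂ : Z₂ × U₂ → Z₂}
    (hF₁ : ContDiff ℝ 1 F₁) (hF₂ : ContDiff ℝ 1 F₂)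
    {Ψ : (Z₁ × Z₁) × Z₂ × Z₂ → Y} {Ψ' : (Z₁ × Z₁) × Z₂ × Z₂ →L[ℝ] Y}
    {Φ : (Z₁ × Z₁) × Z₂ × Z₂ → ℝ} {Φ' : (Z₁ × Z₁) × Z₂ × Z₂ →L[ℝ] ℝ}
    {γ : C(I, Z₁ × U₁) × C(I, Z₂ × U₂)}
    (hγ₁ : IsTrajectory F₁ γ.1) (hγ₂ : IsTrajectory F₂ γ.2)
    (hΨ : HasStrictFDerivAt Ψ Ψ' (twoPhaseEndpointsCLM γ))
    (hΦ : HasStrictFDerivAt Φ Φ' (twoPhaseEndpointsCLM γ))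
    (hextr : IsLocalExtrOn (Φ ∘ twoPhaseEndpointsCLM)
      {η | (IsTrajectory F₁ η.1 ∧ IsTrajectory F₂ η.2) ∧
        Ψ (twoPhaseEndpointsCLM η) = Ψ (twoPhaseEndpointsCLM γ)} γ) :
    ∃ (Λ : Y →L[ℝ] ℝ) (c : ℝ) (q₁ : I → Z₁ →L[ℝ] ℝ) (q₂ : I → Z₂ →L[ℝ] ℝ),
      (c = 1 ∨ c = 0 ∧ Λ ≠ 0) ∧
      IsAdjointArc (fderivAlong hF₁ γ.1) ((Λ ∘L Ψ' + c • Φ') ∘L .inl ℝ _ _) q₁ ∧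
      IsAdjointArc (fderivAlong hF₂ γ.2) ((Λ ∘L Ψ' + c • Φ') ∘L .inr ℝ _ _) q₂ := by
  obtain ⟨Λ, c, hΛc, hvar⟩ :=
    exists_multiplier_of_isLocalExtrOn_trajectories hF₁ hF₂ hγ₁ hγ₂ hΨ hΦ hextr
  obtain ⟨q₁, hq₁⟩ := exists_isAdjointArc (b := (Λ ∘L Ψ' + c • Φ') ∘L .inl ℝ _ _) fun δ hδ =>
    hvar δ 0 hδ (isLinearTrajectory_zero _)
  obtain ⟨q₂, hq₂⟩ := exists_isAdjointArc (b := (Λ ∘L Ψ' + c • Φ') ∘L .inr ℝ _ _) fun δ hδ =>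
    hvar 0 δ (isLinearTrajectory_zero _) hδ
  exact ⟨Λ, c, q₁, q₂, hΛc, hq₁, hq₂⟩

end TwoPhaseMayer

section Reparametrization

variable {E : Type*} [NormedAddCommGroup E] [NormedSpace ℝ E] {T w : I → ℝ} {y v : I → E}

theorem IsPrimitive.range_eq_Icc (hT : IsPrimitive T w) (hw : ∀ s, 0 < w s) :
    range T = Icc (T 0) (T 1) := by
  have hmono := (hT.strictMono hw).monotone
  refine Subset.antisymm (range_subset_iff.2 fun s => ⟨hmono s.2.1, hmono s.2.2⟩) fun t ht => ?_
  exact mem_range_of_exists_le_of_exists_ge hT.continuous ⟨0, ht.1⟩ ⟨1, ht.2⟩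

theorem IsPrimitive.continuousWithinAt_invFun (hT : IsPrimitive T w) (hw : ∀ s, 0 < w s) (s : I) :
    ContinuousWithinAt (Function.invFun T) (Icc (T 0) (T 1)) (T s) := by
  have hinj := (hT.strictMono hw).injective
  have hemb := hT.continuous.isClosedEmbedding hinj
  rw [ContinuousWithinAt, ← hT.range_eq_Icc hw, ← hemb.isInducing.map_nhds_eq, tendsto_map'_iff,
    Function.invFun_comp hinj, Function.leftInverse_invFun hinj s]
  exact tendsto_id

theorem IsPrimitive.hasDerivWithinAt_invFun (hT : IsPrimitive T w) (hw : ∀ s, 0 < w s) (s : I) :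
    HasDerivWithinAt (fun t => ((Function.invFun T t : I) : ℝ)) (w s)⁻¹
      (Icc (T 0) (T 1)) (T s) := by
  have hleft := Function.leftInverse_invFun (hT.strictMono hw).injective s
  have htendsto : Tendsto (fun t => ((Function.invFun T t : I) : ℝ)) (𝓝[Icc (T 0) (T 1)] T s)
      (𝓝[Icc 0 1] ((Function.invFun T (T s) : I) : ℝ)) :=
    tendsto_nhdsWithin_iff.2 ⟨(continuous_subtype_val.tendsto _).comp
      (hT.continuousWithinAt_invFun hw s), .of_forall fun t => (Function.invFun T t).2⟩
  have hTs : HasFDerivWithinAt (IccExtend zero_le_one T)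
      (ContinuousLinearEquiv.unitsEquivAut ℝ (Units.mk0 (w s) (hw s).ne') : ℝ →L[ℝ] ℝ)
      (Icc 0 1) ((Function.invFun T (T s) : I) : ℝ) := by
    rw [hleft]
    exact (hT s).hasFDerivWithinAt
  rw [← hT.range_eq_Icc hw] at htendsto ⊢
  refine (HasFDerivWithinAt.of_local_left_inverse htendsto hTs (mem_range_self s)
    ?_).hasDerivWithinAt.congr_deriv ?_
  · filter_upwards [self_mem_nhdsWithin] with t ht
    rw [IccExtend_val]
    exact Function.invFun_eq ht
  · simp

theorem IsPrimitive.hasDerivWithinAt_comp_invFun (hT : IsPrimitive T w) (hw : ∀ s, 0 < w s)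
    (hy : IsPrimitive y fun s => w s • v s) (s : I) :
    HasDerivWithinAt (fun t => y (Function.invFun T t)) (v s) (Icc (T 0) (T 1)) (T s) := by
  have hleft := Function.leftInverse_invFun (hT.strictMono hw).injective s
  have hys : HasDerivWithinAt (IccExtend zero_le_one y) (w s • v s) (Icc 0 1)
      ((Function.invFun T (T s) : I) : ℝ) := by
    rw [hleft]
    exact hy s
  simpa [Function.comp_def, smul_smul, (hw s).ne'] using
    hys.scomp (T s) (hT.hasDerivWithinAt_invFun hw s) fun t _ => (Function.invFun T t).2

end Reparametrization

section TimeDilation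

variable {E K : Type*} [NormedAddCommGroup E] [NormedSpace ℝ E]
  [NormedAddCommGroup K] {f : E → K → ℝ → E} {L : E → K → ℝ → ℝ}

/-- `x` solves `ẋ = f(x, u, t)` on the nondegenerate interval `[a, b]`, with continuous control
`u`. -/
structure IsPhase (f : E → K → ℝ → E) (x : ℝ → E) (u : ℝ → K) (a b : ℝ) : Prop where
  lt : a < b
  continuousOn_control : ContinuousOn u (Icc a b)
  dynamics : ∀ t ∈ Icc a b, HasDerivWithinAt x (f (x t) (u t) t) (Icc a b) t

/-- Velocity of (state, time, accumulated cost) as a function of state, control and time. -/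
def extendedVelocity (f : E → K → ℝ → E) (L : E → K → ℝ → ℝ) (p : E × K × ℝ) : E × ℝ × ℝ :=
  (f p.1 p.2.1 p.2.2, 1, L p.1 p.2.1 p.2.2)

/-- Velocity of (state, time, accumulated cost) when time runs with variable speed: the speed is
the second component of the control. -/
def dilatedField (f : E → K → ℝ → E) (L : E → K → ℝ → ℝ) (p : (E × ℝ × ℝ) × K × ℝ) : E × ℝ × ℝ :=
  p.2.2 • extendedVelocity f L (p.1.1, p.2.1, p.1.2.1)

/-- `γ` runs through the process `(x, u)` in another time scale. -/
structure IsDilation (x : ℝ → E) (u : ℝ → K) (γ : C(I, (E × ℝ × ℝ) × K × ℝ)) : Prop where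
  state : ∀ s, (γ s).1.1 = x (γ s).1.2.1
  control : ∀ s, (γ s).2.1 = u (γ s).1.2.1
  speed_pos : ∀ s, 0 < (γ s).2.2

theorem contDiff_extendedVelocity [NormedSpace ℝ K]
    (hf : ContDiff ℝ 1 fun q : E × K × ℝ => f q.1 q.2.1 q.2.2)
    (hL : ContDiff ℝ 1 fun q : E × K × ℝ => L q.1 q.2.1 q.2.2) :
    ContDiff ℝ 1 (extendedVelocity f L) :=
  hf.prodMk (contDiff_const.prodMk hL)

theorem contDiff_dilatedField [NormedSpace ℝ K]
    (hf : ContDiff ℝ 1 fun q : E × K × ℝ => f q.1 q.2.1 q.2.2)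
    (hL : ContDiff ℝ 1 fun q : E × K × ℝ => L q.1 q.2.1 q.2.2) :
    ContDiff ℝ 1 (dilatedField f L) := by
  have hspeed : ContDiff ℝ 1 fun p : (E × ℝ × ℝ) × K × ℝ => p.2.2 := by fun_prop
  exact hspeed.smul ((contDiff_extendedVelocity hf hL).comp
    (by fun_prop : ContDiff ℝ 1 fun p : (E × ℝ × ℝ) × K × ℝ => (p.1.1, p.2.1, p.1.2.1)))

namespace IsPhase

variable {x : ℝ → E} {u : ℝ → K} {a b : ℝ}

theorem continuousOn_state (h : IsPhase f x u a b) : ContinuousOn x (Icc a b) := fun t ht =>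
  (h.dynamics t ht).continuousWithinAt

theorem continuousOn_comp {F : Type*} [TopologicalSpace F] {ℓ : E → K → ℝ → F}
    (h : IsPhase f x u a b) (hℓ : Continuous fun q : E × K × ℝ => ℓ q.1 q.2.1 q.2.2) :
    ContinuousOn (fun t => ℓ (x t) (u t) t) (Icc a b) :=
  hℓ.comp_continuousOn (h.continuousOn_state.prodMk (h.continuousOn_control.prodMk continuousOn_id))

theorem congr_state {y : ℝ → E} (h : IsPhase f x u a b) (hy : EqOn y x (Icc a b)) :
    IsPhase f y u a b :=
  ⟨h.lt, h.continuousOn_control, fun t ht => by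
    rw [hy ht]
    exact (h.dynamics t ht).congr hy (hy ht)⟩

theorem exists_isDilation (h : IsPhase f x u a b)
    (hL : Continuous fun q : E × K × ℝ => L q.1 q.2.1 q.2.2) (c : ℝ) :
    ∃ γ : C(I, (E × ℝ × ℝ) × K × ℝ), IsTrajectory (dilatedField f L) γ ∧ IsDilation x u γ ∧
      (γ 0).1 = (x a, a, c) ∧ (γ 1).1.2.1 = b := by
  have hmaps : MapsTo (AffineMap.lineMap a b : ℝ → ℝ) (Icc 0 1) (Icc a b) := fun s hs =>
    ⟨(left_le_lineMap_iff_nonneg h.lt).2 hs.1, (lineMap_le_right_iff_le_one h.lt).2 hs.2⟩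
  let T : C(I, ℝ) := ⟨fun s => AffineMap.lineMap a b (s : ℝ), by fun_prop⟩
  have hTmem (s : I) : T s ∈ Icc a b := hmaps s.2
  let ℓ : C(I, ℝ) := ⟨fun s => (b - a) • L (x (T s)) (u (T s)) (T s),
    continuous_const.fun_smul ((h.continuousOn_comp hL).comp_continuous T.continuous hTmem)⟩
  have hT : ∀ s ∈ Icc (0 : ℝ) 1, HasDerivWithinAt (AffineMap.lineMap a b) (b - a) (Icc 0 1) s :=
    fun s _ => AffineMap.hasDerivWithinAt_lineMap
  have hstate : IsPrimitive (fun s => x (T s)) fun s => (b - a) • f (x (T s)) (u (T s)) (T s) :=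
    .of_hasDerivWithinAt (f := x ∘ AffineMap.lineMap a b) fun s =>
      (h.dynamics _ (hTmem s)).scomp (s : ℝ) (hT s s.2) hmaps
  have htime : IsPrimitive T fun _ => (b - a) • (1 : ℝ) :=
    .of_hasDerivWithinAt (f := AffineMap.lineMap a b) fun s => by simpa using hT s s.2
  refine ⟨⟨fun s => ((x (T s), T s, (constCLM I c + volterra ℓ) s), u (T s), b - a), ?_⟩,
    hstate.prodMk (htime.prodMk (isPrimitive_const_add_volterra c ℓ)),
    ⟨fun _ => rfl, fun _ => rfl, fun _ => sub_pos.2 h.lt⟩, ?_, ?_⟩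
  · exact ((h.continuousOn_state.comp_continuous T.continuous hTmem).prodMk (by fun_prop)).prodMk
      ((h.continuousOn_control.comp_continuous T.continuous hTmem).prodMk continuous_const)
  · simp [T]
  · simp [T]

end IsPhase

namespace IsTrajectory

variable {γ : C(I, (E × ℝ × ℝ) × K × ℝ)}

theorem isPrimitive_state (hγ : IsTrajectory (dilatedField f L) γ) :
    IsPrimitive (fun s => (γ s).1.1)
      fun s => (γ s).2.2 • f (γ s).1.1 (γ s).2.1 (γ s).1.2.1 :=
  hγ.clm_comp (.fst ℝ E (ℝ × ℝ))

theorem isPrimitive_time (hγ : IsTrajectory (dilatedField f L) γ) :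
    IsPrimitive (fun s => (γ s).1.2.1) fun s => (γ s).2.2 := by
  simpa [dilatedField, extendedVelocity] using hγ.clm_comp (.fst ℝ ℝ ℝ ∘L .snd ℝ E (ℝ × ℝ))

theorem isPrimitive_cost (hγ : IsTrajectory (dilatedField f L) γ) :
    IsPrimitive (fun s => (γ s).1.2.2)
      fun s => (γ s).2.2 * L (γ s).1.1 (γ s).2.1 (γ s).1.2.1 :=
  hγ.clm_comp (.snd ℝ ℝ ℝ ∘L .snd ℝ E (ℝ × ℝ))

theorem exists_isPhase (hγ : IsTrajectory (dilatedField f L) γ) (hpos : ∀ s, 0 < (γ s).2.2) :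
    ∃ x u, IsDilation x u γ ∧ IsPhase f x u (γ 0).1.2.1 (γ 1).1.2.1 := by
  have hT := hγ.isPrimitive_time
  have hleft := Function.leftInverse_invFun (hT.strictMono hpos).injective
  let S := Function.invFun fun s => (γ s).1.2.1
  refine ⟨fun t => (γ (S t)).1.1, fun t => (γ (S t)).2.1,
    ⟨fun s => ?_, fun s => ?_, hpos⟩, hT.strictMono hpos zero_lt_one, ?_, ?_⟩
  · exact congrArg (fun r => (γ r).1.1) (hleft s).symm
  · exact congrArg (fun r => (γ r).2.1) (hleft s).symm
  all_goals
    rw [← hT.range_eq_Icc hpos]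
    rintro _ ⟨s, rfl⟩
    rw [hT.range_eq_Icc hpos]
  · exact (by fun_prop : Continuous fun s => (γ s).2.1).continuousAt.comp_continuousWithinAt
      (hT.continuousWithinAt_invFun hpos s)
  · convert! hT.hasDerivWithinAt_comp_invFun hpos hγ.isPrimitive_state s using 1
    exact congrArg (fun r => f (γ r).1.1 (γ r).2.1 (γ s).1.2.1) (hleft s)

theorem cost_sub_eq_integral {x : ℝ → E} {u : ℝ → K} (hγ : IsTrajectory (dilatedField f L) γ)
    (hd : IsDilation x u γ) (h : IsPhase f x u (γ 0).1.2.1 (γ 1).1.2.1)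
    (hL : Continuous fun q : E × K × ℝ => L q.1 q.2.1 q.2.2) :
    ∫ t in (γ 0).1.2.1..(γ 1).1.2.1, L (x t) (u t) t = (γ 1).1.2.2 - (γ 0).1.2.2 := by
  have hT := hγ.isPrimitive_time
  have hleft := Function.leftInverse_invFun (hT.strictMono hd.speed_pos).injective
  let C : ℝ → ℝ := fun t => (γ (Function.invFun (fun s => (γ s).1.2.1) t)).1.2.2
  have hC : ∀ t ∈ Icc (γ 0).1.2.1 (γ 1).1.2.1,
      HasDerivWithinAt C (L (x t) (u t) t) (Icc (γ 0).1.2.1 (γ 1).1.2.1) t := by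
    rw [← hT.range_eq_Icc hd.speed_pos]
    rintro _ ⟨s, rfl⟩
    rw [hT.range_eq_Icc hd.speed_pos, ← hd.state, ← hd.control]
    exact hT.hasDerivWithinAt_comp_invFun hd.speed_pos hγ.isPrimitive_cost s
  have hCT (s : I) : C (γ s).1.2.1 = (γ s).1.2.2 := congrArg (fun r => (γ r).1.2.2) (hleft s)
  rw [← hCT 0, ← hCT 1]
  exact intervalIntegral.integral_eq_sub_of_hasDerivAt_of_le h.lt.le
    (fun t ht => (hC t ht).continuousWithinAt)
    (fun t ht => (hC t (Ioo_subset_Icc_self ht)).hasDerivAt (Icc_mem_nhds ht.1 ht.2))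
    ((h.continuousOn_comp hL).intervalIntegrable_of_Icc h.lt.le)

end IsTrajectory

end TimeDilation

section Hamiltonian

variable {E K : Type*} [NormedAddCommGroup E] [InnerProductSpace ℝ E]
  {f : E → K → ℝ → E} {L : E → K → ℝ → ℝ}

/-- The Hamiltonian `c L + pᵀ f`, with a multiplier `c` for the stage cost. -/
noncomputable def hamiltonian (f : E → K → ℝ → E) (L : E → K → ℝ → ℝ) (c : ℝ) (y p : E) (v : K)
    (t : ℝ) : ℝ :=
  c * L y v t + inner ℝ p (f y v t)

/-- The augmented co-state `(λ, λ_t, c)` of a process `(x, u)` with co-state `p`, acting on triples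
(state, time, accumulated cost), where `λ_t` is minus the Hamiltonian. -/
noncomputable def augmentedCostate (f : E → K → ℝ → E) (L : E → K → ℝ → ℝ) (c : ℝ) (x : ℝ → E)
    (u : ℝ → K) (p : ℝ → E) (t : ℝ) : E × ℝ × ℝ →L[ℝ] ℝ :=
  (innerSL ℝ (p t)).coprod
    ((-hamiltonian f L c (x t) (p t) (u t) t • ContinuousLinearMap.id ℝ ℝ).coprod
      (c • ContinuousLinearMap.id ℝ ℝ))

theorem augmentedCostate_apply (f : E → K → ℝ → E) (L : E → K → ℝ → ℝ) (c : ℝ) (x : ℝ → E)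
    (u : ℝ → K) (p : ℝ → E) (t : ℝ) (ζ : E × ℝ × ℝ) :
    augmentedCostate f L c x u p t ζ =
      inner ℝ (p t) ζ.1 - hamiltonian f L c (x t) (p t) (u t) t * ζ.2.1 + c * ζ.2.2 := by
  simp only [augmentedCostate, ContinuousLinearMap.coprod_apply, innerSL_apply_apply,
    smul_apply, ContinuousLinearMap.id_apply, smul_eq_mul]
  ring

variable [CompleteSpace E]

/-- The Riesz representation; unlike `InnerProductSpace.toDual`, it is linear and not merely
conjugate linear. -/
noncomputable def rieszCLM (E : Type*) [NormedAddCommGroup E] [InnerProductSpace ℝ E]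
    [CompleteSpace E] : (E →L[ℝ] ℝ) →L[ℝ] E :=
  LinearMap.mkContinuous
    { toFun := (InnerProductSpace.toDual ℝ E).symm
      map_add' := map_add _
      map_smul' := fun c ℓ => by simp } 1 fun ℓ => by simp

theorem inner_rieszCLM (ℓ : E →L[ℝ] ℝ) (v : E) : inner ℝ (rieszCLM E ℓ) v = ℓ v :=
  InnerProductSpace.toDual_symm_apply

theorem hamiltonian_rieszCLM (Q : E × ℝ × ℝ →L[ℝ] ℝ) (y : E) (v : K) (t : ℝ) :
    hamiltonian f L (Q (0, 0, 1)) y (rieszCLM E (Q ∘L .inl ℝ E (ℝ × ℝ))) v t =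
      Q (extendedVelocity f L (y, v, t)) - Q (0, 1, 0) := by
  have hsplit : extendedVelocity f L (y, v, t) =
      (f y v t, 0, 0) + (0, 1, 0) + L y v t • (0, 0, 1) := by
    simp [extendedVelocity]
  simp only [hamiltonian, hsplit, inner_rieszCLM, map_add, map_smul, smul_eq_mul,
    ContinuousLinearMap.comp_apply, ContinuousLinearMap.inl_apply, Prod.mk_zero_zero]
  ring

theorem gradient_hamiltonian_state [NormedAddCommGroup K] [NormedSpace ℝ K]
    (Q : E × ℝ × ℝ →L[ℝ] ℝ) {y : E} {v : K} {t : ℝ}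
    (hG : DifferentiableAt ℝ (extendedVelocity f L) (y, v, t)) :
    gradient (fun y => hamiltonian f L (Q (0, 0, 1)) y (rieszCLM E (Q ∘L .inl ℝ E (ℝ × ℝ))) v t) y =
      rieszCLM E (Q ∘L fderiv ℝ (extendedVelocity f L) (y, v, t) ∘L .inl ℝ E (K × ℝ)) := by
  simp only [hamiltonian_rieszCLM]
  have hslice : HasFDerivAt (fun y : E => (y, v, t)) (.inl ℝ E (K × ℝ)) y :=
    hasFDerivAt_prodMk_left y (v, t)
  exact ((Q.hasFDerivAt.comp y (hG.hasFDerivAt.comp y hslice)).sub_const _).hasGradientAt.gradient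

theorem gradient_hamiltonian_control [NormedAddCommGroup K] [InnerProductSpace ℝ K]
    [CompleteSpace K] (Q : E × ℝ × ℝ →L[ℝ] ℝ) {y : E} {v : K} {t : ℝ}
    (hG : DifferentiableAt ℝ (extendedVelocity f L) (y, v, t)) :
    gradient (fun v => hamiltonian f L (Q (0, 0, 1)) y (rieszCLM E (Q ∘L .inl ℝ E (ℝ × ℝ))) v t) v =
      rieszCLM K (Q ∘L fderiv ℝ (extendedVelocity f L) (y, v, t) ∘L .inr ℝ E (K × ℝ) ∘L
        .inl ℝ K ℝ) := by
  simp only [hamiltonian_rieszCLM]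
  have hslice : HasFDerivAt (fun v : K => (y, v, t)) (.inr ℝ E (K × ℝ) ∘L .inl ℝ K ℝ) v :=
    (hasFDerivAt_prodMk_right y (v, t)).comp v (hasFDerivAt_prodMk_left v t)
  exact ((Q.hasFDerivAt.comp v (hG.hasFDerivAt.comp v hslice)).sub_const _).hasGradientAt.gradient

end Hamiltonian

section DilatedAdjointArcs

variable {E K : Type*} [NormedAddCommGroup E] [NormedSpace ℝ E]
  [NormedAddCommGroup K] [NormedSpace ℝ K] {f : E → K → ℝ → E} {L : E → K → ℝ → ℝ}

theorem fderiv_dilatedField_apply {p : (E × ℝ × ℝ) × K × ℝ}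
    (hG : DifferentiableAt ℝ (extendedVelocity f L) (p.1.1, p.2.1, p.1.2.1))
    (δ : (E × ℝ × ℝ) × K × ℝ) :
    fderiv ℝ (dilatedField f L) p δ =
      p.2.2 • fderiv ℝ (extendedVelocity f L) (p.1.1, p.2.1, p.1.2.1) (δ.1.1, δ.2.1, δ.1.2.1) +
        δ.2.2 • extendedVelocity f L (p.1.1, p.2.1, p.1.2.1) := by
  have hid : HasFDerivAt (fun z => z) (ContinuousLinearMap.id ℝ _) p := hasFDerivAt_id p
  have harg := hid.fst.fst.prodMk (hid.snd.fst.prodMk hid.fst.snd.fst)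
  have hvelocity := hG.hasFDerivAt.comp p harg
  have hfield : HasFDerivAt (dilatedField f L) _ p := hid.snd.snd.smul hvelocity
  rw [hfield.fderiv]
  rfl

variable {γ : C(I, (E × ℝ × ℝ) × K × ℝ)} {hF : ContDiff ℝ 1 (dilatedField f L)}
  {b : (E × ℝ × ℝ) × (E × ℝ × ℝ) →L[ℝ] ℝ} {q : I → E × ℝ × ℝ →L[ℝ] ℝ}

namespace IsAdjointArc

theorem apply_cost_eq (hq : IsAdjointArc (fderivAlong hF γ) b q)
    (hG : Differentiable ℝ (extendedVelocity f L)) (s : I) : q s (0, 0, 1) = q 0 (0, 0, 1) := by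
  refine IsPrimitive.eq_apply_zero (y := fun s => q s (0, 0, 1)) ?_ s
  convert! hq.adjoint.clm_comp (ContinuousLinearMap.apply ℝ ℝ (0, 0, 1)) using 1
  funext r
  simp [fderiv_dilatedField_apply hG.differentiableAt, Prod.mk_zero_zero]

theorem stationary_control (hq : IsAdjointArc (fderivAlong hF γ) b q)
    (hG : Differentiable ℝ (extendedVelocity f L)) {s : I} (hpos : 0 < (γ s).2.2) :
    q s ∘L fderiv ℝ (extendedVelocity f L) ((γ s).1.1, (γ s).2.1, (γ s).1.2.1) ∘L
      .inr ℝ E (K × ℝ) ∘L .inl ℝ K ℝ = 0 := by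
  ext v
  have h := DFunLike.congr_fun (hq.stationary s) (v, 0)
  simpa [fderiv_dilatedField_apply hG.differentiableAt, hpos.ne'] using h

theorem stationary_speed (hq : IsAdjointArc (fderivAlong hF γ) b q)
    (hG : Differentiable ℝ (extendedVelocity f L)) (s : I) :
    q s (extendedVelocity f L ((γ s).1.1, (γ s).2.1, (γ s).1.2.1)) = 0 := by
  have h := DFunLike.congr_fun (hq.stationary s) (0, 1)
  simpa [fderiv_dilatedField_apply hG.differentiableAt, Prod.mk_zero_zero] using h

end IsAdjointArc

end DilatedAdjointArcs

section PhaseCostates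

variable {E K : Type*} [NormedAddCommGroup E] [InnerProductSpace ℝ E] [CompleteSpace E]
  [NormedAddCommGroup K] [InnerProductSpace ℝ K] {f : E → K → ℝ → E} {L : E → K → ℝ → ℝ}

/-- `p` is a co-state of the process `(x, u)` on `[a, b]`, with cost multiplier `c`. -/
structure IsPhaseCostate [CompleteSpace K] (f : E → K → ℝ → E) (L : E → K → ℝ → ℝ) (c : ℝ)
    (x : ℝ → E) (u : ℝ → K) (a b : ℝ) (p : ℝ → E) : Prop where
  adjoint : ∀ t ∈ Icc a b, HasDerivWithinAt p
    (-gradient (fun y => hamiltonian f L c y (p t) (u t) t) (x t)) (Icc a b) t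
  stationary : ∀ t ∈ Icc a b, gradient (fun v => hamiltonian f L c (x t) (p t) v t) (u t) = 0

variable {γ : C(I, (E × ℝ × ℝ) × K × ℝ)} {hF : ContDiff ℝ 1 (dilatedField f L)}
  {b : (E × ℝ × ℝ) × (E × ℝ × ℝ) →L[ℝ] ℝ} {q : I → E × ℝ × ℝ →L[ℝ] ℝ}

namespace IsAdjointArc

theorem isPrimitive_rieszCLM (hq : IsAdjointArc (fderivAlong hF γ) b q)
    (hG : Differentiable ℝ (extendedVelocity f L)) :
    IsPrimitive (fun s => rieszCLM E (q s ∘L .inl ℝ E (ℝ × ℝ))) fun s =>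
      (γ s).2.2 • -rieszCLM E (q s ∘L fderiv ℝ (extendedVelocity f L)
        ((γ s).1.1, (γ s).2.1, (γ s).1.2.1) ∘L .inl ℝ E (K × ℝ)) := by
  convert! hq.adjoint.clm_comp
    (rieszCLM E ∘L (ContinuousLinearMap.compL ℝ E (E × ℝ × ℝ) ℝ).flip (.inl ℝ E (ℝ × ℝ))) using 1
  funext s
  refine ext_inner_right ℝ fun v => ?_
  simp [inner_rieszCLM, inner_smul_left, Prod.mk_zero_zero,
    fderiv_dilatedField_apply hG.differentiableAt]

theorem exists_isPhaseCostate [CompleteSpace K] {x : ℝ → E} {u : ℝ → K}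
    (hq : IsAdjointArc (fderivAlong hF γ) b q) (hG : Differentiable ℝ (extendedVelocity f L))
    (hγ : IsTrajectory (dilatedField f L) γ) (hd : IsDilation x u γ) :
    ∃ p c, IsPhaseCostate f L c x u (γ 0).1.2.1 (γ 1).1.2.1 p ∧
      ∀ s, q s = augmentedCostate f L c x u p (γ s).1.2.1 := by
  have hT := hγ.isPrimitive_time
  have hleft := Function.leftInverse_invFun (hT.strictMono hd.speed_pos).injective
  let p : ℝ → E := fun t =>
    rieszCLM E (q (Function.invFun (fun s => (γ s).1.2.1) t) ∘L .inl ℝ E (ℝ × ℝ))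
  have hp (s : I) : p (γ s).1.2.1 = rieszCLM E (q s ∘L .inl ℝ E (ℝ × ℝ)) :=
    congrArg (fun r => rieszCLM E (q r ∘L .inl ℝ E (ℝ × ℝ))) (hleft s)
  refine ⟨p, q 0 (0, 0, 1), ⟨?_, ?_⟩, fun s => ?_⟩
  · rw [← hT.range_eq_Icc hd.speed_pos]
    rintro _ ⟨s, rfl⟩
    rw [hT.range_eq_Icc hd.speed_pos, hp, ← hd.state, ← hd.control, ← hq.apply_cost_eq hG s,
      gradient_hamiltonian_state (q s) hG.differentiableAt]
    exact hT.hasDerivWithinAt_comp_invFun hd.speed_pos (hq.isPrimitive_rieszCLM hG) s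
  · rw [← hT.range_eq_Icc hd.speed_pos]
    rintro _ ⟨s, rfl⟩
    rw [hp, ← hd.state, ← hd.control, ← hq.apply_cost_eq hG s,
      gradient_hamiltonian_control (q s) hG.differentiableAt,
      hq.stationary_control hG (hd.speed_pos s), map_zero]
  · have hH := hamiltonian_rieszCLM (f := f) (L := L) (q s) (γ s).1.1 (γ s).2.1 (γ s).1.2.1
    rw [hq.stationary_speed hG s, zero_sub] at hH
    ext ζ <;> simp [augmentedCostate_apply, hp, ← hd.state, ← hd.control,
      ← hq.apply_cost_eq hG s, hH, inner_rieszCLM]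

end IsAdjointArc

end PhaseCostates

section AbnormalCostates

variable {E K : Type*} [NormedAddCommGroup E] [InnerProductSpace ℝ E] [CompleteSpace E]
  {f : E → K → ℝ → E} {L : E → K → ℝ → ℝ}

theorem hasGradientAt_hamiltonian_zero {p y : E} {v : K} {t : ℝ} {f' : E →L[ℝ] E}
    (hf : HasFDerivAt (fun y => f y v t) f' y) :
    HasGradientAt (fun y => hamiltonian f L 0 y p v t) (ContinuousLinearMap.adjoint f' p) y := by
  have hinner := (innerSL ℝ p).hasFDerivAt.comp y hf
  rw [hasGradientAt_iff_hasFDerivAt]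
  simp only [hamiltonian, zero_mul, zero_add]
  refine hinner.congr_fderiv ?_
  ext w
  simp [ContinuousLinearMap.adjoint_inner_left]

theorem eqOn_zero_of_hasDerivWithinAt_linear {F : Type*} [NormedAddCommGroup F] [NormedSpace ℝ F]
    {A : ℝ → F →L[ℝ] F} {p : ℝ → F} {a b : ℝ} (hA : ContinuousOn A (Icc a b))
    (hp : ∀ t ∈ Icc a b, HasDerivWithinAt p (A t (p t)) (Icc a b) t) (hb : p b = 0) :
    EqOn p 0 (Icc a b) := by
  obtain ⟨C, hC⟩ := isCompact_Icc.exists_bound_of_continuousOn hA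
  refine ODE_solution_unique_of_mem_Icc_left (K := C.toNNReal) (s := fun _ => univ)
    (v := fun t y => A t y) (fun t ht => ?_) (fun t ht => (hp t ht).continuousWithinAt)
    (fun t ht => ?_) (fun _ _ => mem_univ _) continuousOn_const (fun t _ => ?_)
    (fun _ _ => mem_univ _) hb
  · refine ((A t).lipschitz.weaken ?_).lipschitzOnWith
    exact (norm_toNNReal (a := A t)).symm.trans_le
      (Real.toNNReal_le_toNNReal (hC t (Ioc_subset_Icc_self ht)))
  · exact (hp t (Ioc_subset_Icc_self ht)).mono_of_mem_nhdsWithin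
      (mem_of_superset (Icc_mem_nhdsLE ht.1) (Icc_subset_Icc_right ht.2))
  · simpa using! hasDerivWithinAt_const t (Iic t) (0 : F)

theorem IsPhaseCostate.eqOn_zero [NormedAddCommGroup K] [InnerProductSpace ℝ K] [CompleteSpace K]
    {x : ℝ → E} {u : ℝ → K} {a b : ℝ} {p : ℝ → E} (h : IsPhaseCostate f L 0 x u a b p)
    (hx : IsPhase f x u a b) (hf : ContDiff ℝ 1 fun q : E × K × ℝ => f q.1 q.2.1 q.2.2)
    (hb : p b = 0) : EqOn p 0 (Icc a b) := by
  let A (t : ℝ) : E →L[ℝ] E :=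
    fderiv ℝ (fun q : E × K × ℝ => f q.1 q.2.1 q.2.2) (x t, u t, t) ∘L .inl ℝ E (K × ℝ)
  have hA : ContinuousOn A (Icc a b) := hx.continuousOn_comp
    (ℓ := fun y v t => fderiv ℝ (fun q : E × K × ℝ => f q.1 q.2.1 q.2.2) (y, v, t) ∘L
      .inl ℝ E (K × ℝ))
    ((hf.continuous_fderiv one_ne_zero).clm_comp continuous_const)
  have hslice (t : ℝ) : HasFDerivAt (fun y => f y (u t) t) (A t) (x t) :=
    (hf.differentiable one_ne_zero _).hasFDerivAt.comp (f := fun y => (y, u t, t)) (x t)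
      (hasFDerivAt_prodMk_left (x t) (u t, t))
  refine eqOn_zero_of_hasDerivWithinAt_linear
    (A := fun t => -((ContinuousLinearMap.adjoint (𝕜 := ℝ)) (A t))) ?_ (fun t ht => ?_) hb
  · exact (ContinuousLinearMap.adjoint.continuous.comp_continuousOn hA).neg
  · have hadjoint := h.adjoint t ht
    rwa [(hasGradientAt_hamiltonian_zero (hslice t)).gradient] at hadjoint

end AbnormalCostates

section Stability

variable {X : Type*} [TopologicalSpace X] {h D : X → ℝ} {γ₀ : C(I, X)}

theorem eventually_forall_pos (hD : Continuous D) (hpos : ∀ s, 0 < D (γ₀ s)) :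
    ∀ᶠ γ in 𝓝 γ₀, ∀ s, 0 < D (γ s) :=
  (ContinuousMap.eventually_mapsTo isCompact_univ (isOpen_Ioi.preimage hD)
    fun s _ => hpos s).mono fun _ hγ s => hγ (mem_univ s)

theorem eventually_forall_lt_one_neg (hh : Continuous h) (hD : Continuous D)
    (hneg : ∀ s < 1, h (γ₀ s) < 0) (hpos : 0 < D (γ₀ 1)) :
    ∀ᶠ γ in 𝓝 γ₀, IsPrimitive (fun s => h (γ s)) (fun s => D (γ s)) → h (γ 1) = 0 →
      ∀ s < 1, h (γ s) < 0 := by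
  have hev : ∀ᶠ s in 𝓝 1, 0 < D (γ₀ s) :=
    (hD.comp γ₀.continuous).continuousAt.eventually_const_lt hpos
  obtain ⟨l, hl, hlpos⟩ := exists_Ioc_subset_of_mem_nhds hev ⟨0, zero_lt_one⟩
  obtain ⟨a, hla, ha⟩ := exists_between hl
  filter_upwards [ContinuousMap.eventually_mapsTo (K := Iic a) isClosed_Iic.isCompact
      (isOpen_Iio.preimage hh) fun s hs => hneg s (lt_of_le_of_lt hs ha),
    ContinuousMap.eventually_mapsTo (K := Ici a) isClosed_Ici.isCompact
      (isOpen_Ioi.preimage hD) fun s hs => hlpos ⟨hla.trans_le hs, s.2.2⟩]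
    with γ hearly hlate hprim hend s hs
  rcases le_total s a with hsa | has
  · exact hearly hsa
  · exact hend ▸ hprim.strictMonoOn_Ici (fun r hr => hlate hr) has ha.le hs

theorem eventually_forall_pos_pos (hh : Continuous h) (hD : Continuous D)
    (hpos : ∀ s > 0, 0 < h (γ₀ s)) (hpos₀ : 0 < D (γ₀ 0)) :
    ∀ᶠ γ in 𝓝 γ₀, IsPrimitive (fun s => h (γ s)) (fun s => D (γ s)) → h (γ 0) = 0 →
      ∀ s > 0, 0 < h (γ s) := by
  let symm : C(I, I) := ⟨σ, unitInterval.continuous_symm⟩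
  have hrev : ∀ᶠ γ in 𝓝 (γ₀.comp symm), IsPrimitive (fun s => -h (γ s)) (fun s => D (γ s)) →
      -h (γ 1) = 0 → ∀ s < 1, -h (γ s) < 0 :=
    eventually_forall_lt_one_neg hh.neg hD
      (fun s hs => neg_lt_zero.2 (hpos _ (unitInterval.lt_symm_comm.2 (by simpa using hs))))
      (by simpa [symm] using hpos₀)
  filter_upwards [(ContinuousMap.continuous_precomp symm).continuousAt.eventually hrev]
    with γ hγ hprim hstart s hs
  have hprim' : IsPrimitive (fun s => -h (γ (σ s))) fun s => D (γ (σ s)) := by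
    simpa using hprim.reverse.clm_comp (-ContinuousLinearMap.id ℝ ℝ)
  simpa [symm] using hγ hprim' (by simpa [symm] using hstart) (σ s)
    (unitInterval.symm_lt_comm.2 (by simpa using hs))

end Stability

section OneSidedDerivatives

variable {h : ℝ → ℝ} {d a b : ℝ}

theorem nonneg_of_hasDerivWithinAt_of_isMaxOn_right (hab : a < b)
    (hd : HasDerivWithinAt h d (Icc a b) b) (hmax : IsMaxOn h (Icc a b) b) : 0 ≤ d := by
  have htangent : a - b ∈ posTangentConeAt (Icc a b) b :=
    sub_mem_posTangentConeAt_of_segment_subset (segment_symm ℝ a b ▸ segment_eq_Icc hab.le).subset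
  exact nonneg_of_mul_nonpos_right
    (by simpa using hmax.localize.hasFDerivWithinAt_nonpos hd.hasFDerivWithinAt htangent)
    (sub_neg.2 hab)

theorem nonneg_of_hasDerivWithinAt_of_isMinOn_left (hab : a < b)
    (hd : HasDerivWithinAt h d (Icc a b) a) (hmin : IsMinOn h (Icc a b) a) : 0 ≤ d := by
  have htangent : b - a ∈ posTangentConeAt (Icc a b) a :=
    sub_mem_posTangentConeAt_of_segment_subset (segment_eq_Icc hab.le).subset
  exact nonneg_of_mul_nonneg_right
    (by simpa using hmin.localize.hasFDerivWithinAt_nonneg hd.hasFDerivWithinAt htangent)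
    (sub_pos.2 hab)

end OneSidedDerivatives

section TwoPhases

variable {E K : Type*} [NormedAddCommGroup E] [NormedAddCommGroup K]

theorem exists_eqOn_Iic_eqOn_Ici {α β : Type*} [LinearOrder α] {y z : α → β} {a : α}
    (h : y a = z a) : ∃ x, EqOn x y (Iic a) ∧ EqOn x z (Ici a) := by
  classical
  refine ⟨(Iic a).piecewise y z, piecewise_eqOn _ _ _, fun t ht => ?_⟩
  rcases (mem_Ici.1 ht).eq_or_lt with rfl | hlt
  · rw [piecewise_eq_of_mem _ _ _ self_mem_Iic, h]
  · exact piecewise_eq_of_notMem _ _ _ (notMem_Iic.2 hlt)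

theorem IsDilation.congr_state {x y : ℝ → E} {u : ℝ → K} {γ : C(I, (E × ℝ × ℝ) × K × ℝ)}
    (hd : IsDilation x u γ) (h : ∀ s, y (γ s).1.2.1 = x (γ s).1.2.1) : IsDilation y u γ :=
  ⟨fun s => (hd.state s).trans (h s).symm, hd.control, hd.speed_pos⟩

variable [NormedSpace ℝ E] {f₁ f₂ : E → K → ℝ → E} {L₁ L₂ : E → K → ℝ → ℝ}

theorem exists_isDilation_isPhase_of_eq {γ₁ γ₂ : C(I, (E × ℝ × ℝ) × K × ℝ)}
    (hγ₁ : IsTrajectory (dilatedField f₁ L₁) γ₁) (hγ₂ : IsTrajectory (dilatedField f₂ L₂) γ₂)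
    (hpos₁ : ∀ s, 0 < (γ₁ s).2.2) (hpos₂ : ∀ s, 0 < (γ₂ s).2.2) (hmatch : (γ₂ 0).1 = (γ₁ 1).1) :
    ∃ x u₁ u₂, (IsDilation x u₁ γ₁ ∧ IsPhase f₁ x u₁ (γ₁ 0).1.2.1 (γ₁ 1).1.2.1) ∧
      IsDilation x u₂ γ₂ ∧ IsPhase f₂ x u₂ (γ₁ 1).1.2.1 (γ₂ 1).1.2.1 := by
  obtain ⟨x₁, u₁, hd₁, hx₁⟩ := hγ₁.exists_isPhase hpos₁
  obtain ⟨x₂, u₂, hd₂, hx₂⟩ := hγ₂.exists_isPhase hpos₂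
  have hmono₁ := (hγ₁.isPrimitive_time.strictMono hpos₁).monotone
  have hmono₂ := (hγ₂.isPrimitive_time.strictMono hpos₂).monotone
  have hcross : x₁ (γ₁ 1).1.2.1 = x₂ (γ₁ 1).1.2.1 := by
    rw [← hd₁.state, ← hmatch, hd₂.state]
  obtain ⟨x, hleft, hright⟩ := exists_eqOn_Iic_eqOn_Ici hcross
  refine ⟨x, u₁, u₂, ⟨hd₁.congr_state fun s => hleft (hmono₁ s.2.2),
    hx₁.congr_state fun t ht => hleft ht.2⟩, hd₂.congr_state fun s => ?_, ?_⟩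
  · exact hright (hmatch ▸ hmono₂ s.2.1)
  · rw [hmatch] at hx₂
    exact hx₂.congr_state fun t ht => hright ht.1

end TwoPhases

/-- Values of (state, time, accumulated cost). -/
abbrev PhaseState (n : ℕ) := EuclideanSpace ℝ (Fin n) × ℝ × ℝ

/-- Curves of (state, time, accumulated cost), controls and speeds on the unit interval. -/
abbrev PhaseCurve (n k : ℕ) := C(I, PhaseState n × EuclideanSpace ℝ (Fin k) × ℝ)

namespace SwitchedProblem

variable {n k : ℕ} {P : SwitchedProblem n k} {x : ℝ → EuclideanSpace ℝ (Fin n)}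
  {u₁ u₂ : ℝ → EuclideanSpace ℝ (Fin k)} {τ : ℝ}

theorem IsAdmissible.isPhase₁ (h : P.IsAdmissible x u₁ u₂ τ) : IsPhase P.f₁ x u₁ P.t₀ τ :=
  ⟨h.mem_Ioo.1, h.continuousOn₁, h.dynamics₁⟩

theorem IsAdmissible.isPhase₂ (h : P.IsAdmissible x u₁ u₂ τ) : IsPhase P.f₂ x u₂ τ P.t_f :=
  ⟨h.mem_Ioo.2, h.continuousOn₂, h.dynamics₂⟩

section Interface

theorem IsSmooth.hasFDerivAt_interface (hP : P.IsSmooth)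
    (q : EuclideanSpace ℝ (Fin n) × ℝ) :
    HasFDerivAt (fun q : EuclideanSpace ℝ (Fin n) × ℝ => P.g q.1 q.2)
      ((innerSL ℝ (P.normal q.1 q.2)).coprod (P.timeSlope q.1 q.2 • .id ℝ ℝ)) q := by
  have hg := (hP.g.differentiable one_ne_zero q).hasFDerivAt
  have hstate : HasFDerivAt (fun y => P.g y q.2) _ q.1 :=
    hg.comp (f := fun y => (y, q.2)) q.1 (hasFDerivAt_prodMk_left q.1 q.2)
  have htime : HasFDerivAt (fun t => P.g q.1 t) _ q.2 :=
    hg.comp (f := fun t => (q.1, t)) q.2 (hasFDerivAt_prodMk_right q.1 q.2)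
  refine hg.congr_fderiv ?_
  ext v
  · simp [normal, inner_gradient_left, hstate.fderiv]
  · simp [timeSlope, htime.hasDerivAt.deriv]

/-- The rate `mᵀ f + μ` at which `g` changes along trajectories of `f`. -/
noncomputable def crossingSpeed (P : SwitchedProblem n k)
    (f : EuclideanSpace ℝ (Fin n) → EuclideanSpace ℝ (Fin k) → ℝ → EuclideanSpace ℝ (Fin n))
    (y : EuclideanSpace ℝ (Fin n)) (v : EuclideanSpace ℝ (Fin k)) (t : ℝ) : ℝ :=
  inner ℝ (P.normal y t) (f y v t) + P.timeSlope y t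

variable {f : EuclideanSpace ℝ (Fin n) → EuclideanSpace ℝ (Fin k) → ℝ → EuclideanSpace ℝ (Fin n)}
  {L : EuclideanSpace ℝ (Fin n) → EuclideanSpace ℝ (Fin k) → ℝ → ℝ}

theorem IsSmooth.continuous_crossingSpeed (hP : P.IsSmooth)
    (hf : Continuous fun q : EuclideanSpace ℝ (Fin n) × EuclideanSpace ℝ (Fin k) × ℝ =>
      f q.1 q.2.1 q.2.2) :
    Continuous fun q : EuclideanSpace ℝ (Fin n) × EuclideanSpace ℝ (Fin k) × ℝ =>
      P.crossingSpeed f q.1 q.2.1 q.2.2 := by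
  have hderiv : Continuous fun q : EuclideanSpace ℝ (Fin n) × EuclideanSpace ℝ (Fin k) × ℝ =>
      fderiv ℝ (fun q : EuclideanSpace ℝ (Fin n) × ℝ => P.g q.1 q.2) (q.1, q.2.2)
        (f q.1 q.2.1 q.2.2, 1) :=
    ((hP.g.continuous_fderiv one_ne_zero).comp (by fun_prop)).clm_apply (hf.prodMk continuous_const)
  refine hderiv.congr fun q => ?_
  simp [(hP.hasFDerivAt_interface _).fderiv, crossingSpeed]

theorem IsSmooth.continuous_interface (hP : P.IsSmooth) :
    Continuous fun z : PhaseState n × EuclideanSpace ℝ (Fin k) × ℝ => P.g z.1.1 z.1.2.1 :=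
  hP.g.continuous.comp (continuous_fst.fst.prodMk continuous_fst.snd.fst)

theorem IsSmooth.continuous_interface_rate (hP : P.IsSmooth)
    (hf : Continuous fun q : EuclideanSpace ℝ (Fin n) × EuclideanSpace ℝ (Fin k) × ℝ =>
      f q.1 q.2.1 q.2.2) :
    Continuous fun z : PhaseState n × EuclideanSpace ℝ (Fin k) × ℝ =>
      z.2.2 * P.crossingSpeed f z.1.1 z.2.1 z.1.2.1 := by
  have hspeed := hP.continuous_crossingSpeed hf
  generalize P.crossingSpeed f = C at hspeed ⊢
  have hargs : Continuous fun z : PhaseState n × EuclideanSpace ℝ (Fin k) × ℝ =>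
      (z.1.1, z.2.1, z.1.2.1) := by fun_prop
  exact continuous_snd.snd.fun_mul (hspeed.comp hargs)

theorem IsSmooth.isPrimitive_interface (hP : P.IsSmooth) {γ : PhaseCurve n k}
    (hγ : IsTrajectory (dilatedField f L) γ) :
    IsPrimitive (fun s => P.g (γ s).1.1 (γ s).1.2.1)
      fun s => (γ s).2.2 * P.crossingSpeed f (γ s).1.1 (γ s).2.1 (γ s).1.2.1 := by
  have h := (hγ.isPrimitive_state.prodMk hγ.isPrimitive_time).fderiv_comp
    fun s => hP.hasFDerivAt_interface ((γ s).1.1, (γ s).1.2.1)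
  convert! h using 1
  funext s
  simp only [crossingSpeed, ContinuousLinearMap.coprod_apply, innerSL_apply_apply, inner_smul_right,
    smul_apply, ContinuousLinearMap.id_apply, smul_eq_mul]
  ring

theorem IsAdmissible.crossingSpeed_pos (hP : P.IsSmooth) (h : P.IsAdmissible x u₁ u₂ τ)
    (htrans : P.IsTransversal x u₁ u₂ τ) :
    0 < P.crossingSpeed P.f₁ (x τ) (u₁ τ) τ ∧ 0 < P.crossingSpeed P.f₂ (x τ) (u₂ τ) τ := by
  have hd {v : EuclideanSpace ℝ (Fin n)} {s : Set ℝ} (hv : HasDerivWithinAt x v s τ) :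
      HasDerivWithinAt (fun t => P.g (x t) t)
        (inner ℝ (P.normal (x τ) τ) v + P.timeSlope (x τ) τ) s τ := by
    simpa [Function.comp_def] using (hP.hasFDerivAt_interface (x τ, τ)).comp_hasDerivWithinAt
      (f := fun t => (x t, t)) τ (hv.prodMk (hasDerivWithinAt_id τ s))
  have hmax : IsMaxOn (fun t => P.g (x t) t) (Icc P.t₀ τ) τ := isMaxOn_iff.2 fun t ht =>
    ht.2.eq_or_lt.elim (fun heq => heq ▸ le_rfl)
      fun hlt => (h.before t ⟨ht.1, hlt⟩).le.trans_eq h.crossing.symm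
  have hmin : IsMinOn (fun t => P.g (x t) t) (Icc τ P.t_f) τ := isMinOn_iff.2 fun t ht =>
    ht.1.eq_or_lt.elim (fun heq => heq ▸ le_rfl)
      fun hlt => h.crossing.trans_le (h.after t ⟨hlt, ht.2⟩).le
  exact ⟨(nonneg_of_hasDerivWithinAt_of_isMaxOn_right h.mem_Ioo.1
      (hd (h.dynamics₁ τ (right_mem_Icc.2 h.mem_Ioo.1.le))) hmax).lt_of_ne' htrans.1,
    (nonneg_of_hasDerivWithinAt_of_isMinOn_left h.mem_Ioo.2
      (hd (h.dynamics₂ τ (left_mem_Icc.2 h.mem_Ioo.2.le))) hmin).lt_of_ne' htrans.2⟩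

end Interface

section EndpointConstraint

/-- The initial condition, the matching condition at the crossing, the interface condition and the
terminal condition, as an equation between the end points of both phases. -/
noncomputable def endpointConstraint (P : SwitchedProblem n k)
    (e : (PhaseState n × PhaseState n) × PhaseState n × PhaseState n) :
    PhaseState n × PhaseState n × ℝ × P.Wᗮ × ℝ :=
  (e.1.1 - (P.x₀, P.t₀, 0), e.2.1 - e.1.2, P.g e.1.2.1 e.1.2.2.1,
    P.Wᗮ.orthogonalProjectionOnto (e.2.2.1 - P.x_f), e.2.2.2.1 - P.t_f)

/-- The performance index in terms of the end points of both phases. -/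
def endpointCost (P : SwitchedProblem n k)
    (e : (PhaseState n × PhaseState n) × PhaseState n × PhaseState n) : ℝ :=
  P.φ e.2.2.1 + e.2.2.2.2

theorem endpointConstraint_eq_zero_iff
    {e : (PhaseState n × PhaseState n) × PhaseState n × PhaseState n} :
    P.endpointConstraint e = 0 ↔ e.1.1 = (P.x₀, P.t₀, 0) ∧ e.2.1 = e.1.2 ∧
      P.g e.1.2.1 e.1.2.2.1 = 0 ∧ e.2.2.1 - P.x_f ∈ P.W ∧ e.2.2.2.1 = P.t_f := by
  simp only [endpointConstraint, Prod.mk_eq_zero, sub_eq_zero,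
    Submodule.orthogonalProjectionOnto_eq_zero_iff, Submodule.orthogonal_orthogonal]

theorem IsSmooth.contDiff_endpointConstraint (hP : P.IsSmooth) :
    ContDiff ℝ 1 P.endpointConstraint := by
  have hinterface : ContDiff ℝ 1
      fun e : (PhaseState n × PhaseState n) × PhaseState n × PhaseState n =>
        P.g e.1.2.1 e.1.2.2.1 :=
    hP.g.comp (by fun_prop : ContDiff ℝ 1
      fun e : (PhaseState n × PhaseState n) × PhaseState n × PhaseState n => (e.1.2.1, e.1.2.2.1))
  unfold endpointConstraint
  fun_prop

theorem IsSmooth.contDiff_endpointCost (hP : P.IsSmooth) : ContDiff ℝ 1 P.endpointCost := by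
  have := hP.φ
  unfold endpointCost
  fun_prop

theorem IsSmooth.fderiv_endpointConstraint_apply (hP : P.IsSmooth)
    (e δ : (PhaseState n × PhaseState n) × PhaseState n × PhaseState n) :
    fderiv ℝ P.endpointConstraint e δ = (δ.1.1, δ.2.1 - δ.1.2,
      inner ℝ (P.normal e.1.2.1 e.1.2.2.1) δ.1.2.1 + P.timeSlope e.1.2.1 e.1.2.2.1 * δ.1.2.2.1,
      P.Wᗮ.orthogonalProjectionOnto δ.2.2.1, δ.2.2.2.1) := by
  have hid : HasFDerivAt (fun z => z) (ContinuousLinearMap.id ℝ _) e := hasFDerivAt_id e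
  have hinterface := (hP.hasFDerivAt_interface (e.1.2.1, e.1.2.2.1)).comp
    (f := fun e : (PhaseState n × PhaseState n) × PhaseState n × PhaseState n =>
      (e.1.2.1, e.1.2.2.1)) e (hid.fst.snd.fst.prodMk hid.fst.snd.snd.fst)
  have hproj := P.Wᗮ.orthogonalProjectionOnto.hasFDerivAt.comp
    (f := fun e : (PhaseState n × PhaseState n) × PhaseState n × PhaseState n =>
      e.2.2.1 - P.x_f) e (hid.snd.snd.fst.sub_const P.x_f)
  have h : HasFDerivAt P.endpointConstraint _ e := (hid.fst.fst.sub_const _).prodMk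
    ((hid.snd.fst.sub hid.fst.snd).prodMk
      (hinterface.prodMk (hproj.prodMk (hid.snd.snd.snd.fst.sub_const _))))
  simp [h.fderiv]

theorem IsSmooth.fderiv_endpointCost_apply (hP : P.IsSmooth)
    (e δ : (PhaseState n × PhaseState n) × PhaseState n × PhaseState n) :
    fderiv ℝ P.endpointCost e δ = inner ℝ (gradient P.φ e.2.2.1) δ.2.2.1 + δ.2.2.2.2 := by
  have hid : HasFDerivAt (fun z => z) (ContinuousLinearMap.id ℝ _) e := hasFDerivAt_id e
  have hφ := (hP.φ.differentiable one_ne_zero e.2.2.1).hasFDerivAt.comp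
    (f := fun e : (PhaseState n × PhaseState n) × PhaseState n × PhaseState n => e.2.2.1) e
    hid.snd.snd.fst
  have h : HasFDerivAt P.endpointCost _ e := hφ.add hid.snd.snd.snd.snd
  simp [h.fderiv, inner_gradient_left]

end EndpointConstraint

section TwoPhaseDilation

/-- `η` consists of trajectories which run through both phases of the process `(x, u₁, u₂, τ)` in
another time scale; the cost accumulates from zero. -/
structure IsTwoPhaseDilation (P : SwitchedProblem n k) (x : ℝ → EuclideanSpace ℝ (Fin n))
    (u₁ u₂ : ℝ → EuclideanSpace ℝ (Fin k)) (τ : ℝ) (η : PhaseCurve n k × PhaseCurve n k) :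
    Prop where
  trajectory₁ : IsTrajectory (dilatedField P.f₁ P.L₁) η.1
  trajectory₂ : IsTrajectory (dilatedField P.f₂ P.L₂) η.2
  dilation₁ : IsDilation x u₁ η.1
  dilation₂ : IsDilation x u₂ η.2
  initial : (η.1 0).1 = (P.x₀, P.t₀, 0)
  matching : (η.2 0).1 = (η.1 1).1
  crossing_time : (η.1 1).1.2.1 = τ
  final_time : (η.2 1).1.2.1 = P.t_f

theorem IsAdmissible.exists_isTwoPhaseDilation (hP : P.IsSmooth)
    (h : P.IsAdmissible x u₁ u₂ τ) : ∃ η, P.IsTwoPhaseDilation x u₁ u₂ τ η := by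
  obtain ⟨γ₁, hγ₁, hd₁, hstart₁, hend₁⟩ := h.isPhase₁.exists_isDilation hP.L₁.continuous 0
  obtain ⟨γ₂, hγ₂, hd₂, hstart₂, hend₂⟩ :=
    h.isPhase₂.exists_isDilation hP.L₂.continuous (γ₁ 1).1.2.2
  refine ⟨(γ₁, γ₂), hγ₁, hγ₂, hd₁, hd₂, h.initial ▸ hstart₁, ?_, hend₁, hend₂⟩
  rw [hstart₂]
  exact Prod.ext (by rw [hd₁.state, hend₁]) (Prod.ext hend₁.symm rfl)

namespace IsTwoPhaseDilation

variable {η : PhaseCurve n k × PhaseCurve n k}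

theorem time_one_zero (hη : P.IsTwoPhaseDilation x u₁ u₂ τ η) : (η.1 0).1.2.1 = P.t₀ := by
  rw [hη.initial]

theorem time_two_zero (hη : P.IsTwoPhaseDilation x u₁ u₂ τ η) : (η.2 0).1.2.1 = τ := by
  rw [hη.matching, hη.crossing_time]

theorem endpointConstraint_eq_zero (hη : P.IsTwoPhaseDilation x u₁ u₂ τ η)
    (h : P.IsAdmissible x u₁ u₂ τ) : P.endpointConstraint (twoPhaseEndpointsCLM η) = 0 := by
  refine endpointConstraint_eq_zero_iff.2 ⟨hη.initial, hη.matching, ?_, ?_, hη.final_time⟩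
  · change P.g (η.1 1).1.1 (η.1 1).1.2.1 = 0
    rw [hη.dilation₁.state, hη.crossing_time, h.crossing]
  · change (η.2 1).1.1 - P.x_f ∈ P.W
    rw [hη.dilation₂.state, hη.final_time]
    exact h.terminal

theorem endpointCost_eq (hη : P.IsTwoPhaseDilation x u₁ u₂ τ η) (hP : P.IsSmooth)
    (h : P.IsAdmissible x u₁ u₂ τ) :
    P.endpointCost (twoPhaseEndpointsCLM η) = P.cost x u₁ u₂ τ := by
  have hcost₁ := hη.trajectory₁.cost_sub_eq_integral hη.dilation₁
    (by simpa only [hη.time_one_zero, hη.crossing_time] using h.isPhase₁) hP.L₁.continuous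
  have hcost₂ := hη.trajectory₂.cost_sub_eq_integral hη.dilation₂
    (by simpa only [hη.time_two_zero, hη.final_time] using h.isPhase₂) hP.L₂.continuous
  simp only [hη.crossing_time, hη.final_time, hη.initial, hη.matching] at hcost₁ hcost₂
  change P.φ (η.2 1).1.1 + (η.2 1).1.2.2 = _
  rw [cost, hcost₁, hcost₂, hη.dilation₂.state, hη.final_time]
  ring

end IsTwoPhaseDilation

theorem exists_isTwoPhaseDilation_isAdmissible {η : PhaseCurve n k × PhaseCurve n k}
    (hη₁ : IsTrajectory (dilatedField P.f₁ P.L₁) η.1)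
    (hη₂ : IsTrajectory (dilatedField P.f₂ P.L₂) η.2)
    (hspeed₁ : ∀ s, 0 < (η.1 s).2.2) (hspeed₂ : ∀ s, 0 < (η.2 s).2.2)
    (hconstr : P.endpointConstraint (twoPhaseEndpointsCLM η) = 0)
    (hneg : ∀ s < 1, P.g (η.1 s).1.1 (η.1 s).1.2.1 < 0)
    (hpos : ∀ s > 0, 0 < P.g (η.2 s).1.1 (η.2 s).1.2.1) :
    ∃ x u₁ u₂ τ, P.IsTwoPhaseDilation x u₁ u₂ τ η ∧ P.IsAdmissible x u₁ u₂ τ := by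
  obtain ⟨hinitial, hmatch, hcross, hterminal, hfinal⟩ := endpointConstraint_eq_zero_iff.1 hconstr
  change (η.1 0).1 = _ at hinitial
  change (η.2 0).1 = (η.1 1).1 at hmatch
  change P.g (η.1 1).1.1 (η.1 1).1.2.1 = 0 at hcross
  change (η.2 1).1.1 - _ ∈ _ at hterminal
  change (η.2 1).1.2.1 = _ at hfinal
  obtain ⟨x, u₁, u₂, ⟨hd₁, hx₁⟩, hd₂, hx₂⟩ :=
    exists_isDilation_isPhase_of_eq hη₁ hη₂ hspeed₁ hspeed₂ hmatch
  have hη : P.IsTwoPhaseDilation x u₁ u₂ (η.1 1).1.2.1 η :=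
    ⟨hη₁, hη₂, hd₁, hd₂, hinitial, hmatch, rfl, hfinal⟩
  have hrange₁ := hη₁.isPrimitive_time.range_eq_Icc hspeed₁
  have hrange₂ := hη₂.isPrimitive_time.range_eq_Icc hspeed₂
  rw [hη.time_one_zero] at hrange₁ hx₁
  rw [hη.time_two_zero, hη.final_time] at hrange₂
  rw [hη.final_time] at hx₂
  refine ⟨x, u₁, u₂, _, hη, ⟨hx₁.lt, hx₂.lt⟩, ?_, ?_, hx₁.continuousOn_control,
    hx₂.continuousOn_control, hx₁.dynamics, hx₂.dynamics, ?_, ?_, ?_⟩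
  · rw [← hη.time_one_zero, ← hd₁.state, hinitial]
  · rwa [← hfinal, ← hd₂.state]
  · intro t ht
    obtain ⟨s, rfl⟩ := hrange₁.ge (Ico_subset_Icc_self ht)
    rw [← hd₁.state]
    exact hneg s (s.2.2.lt_of_ne fun hs => ht.2.ne (by rw [(Subtype.ext hs : s = 1)]))
  · rwa [← hd₁.state]
  · intro t ht
    obtain ⟨s, rfl⟩ := hrange₂.ge (Ioc_subset_Icc_self ht)
    rw [← hd₂.state]
    refine hpos s (s.2.1.lt_of_ne' fun hs => ht.1.ne' ?_)
    rw [(Subtype.ext hs : s = 0)]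
    exact hη.time_two_zero

end TwoPhaseDilation

section Multipliers

variable {η : PhaseCurve n k × PhaseCurve n k}

namespace IsTwoPhaseDilation

theorem interface_neg (hη : P.IsTwoPhaseDilation x u₁ u₂ τ η) (h : P.IsAdmissible x u₁ u₂ τ)
    {s : I} (hs : s < 1) : P.g (η.1 s).1.1 (η.1 s).1.2.1 < 0 := by
  have hmono := hη.trajectory₁.isPrimitive_time.strictMono hη.dilation₁.speed_pos
  rw [hη.dilation₁.state]
  exact h.before _ ⟨hη.time_one_zero.symm.trans_le (hmono.monotone s.2.1),
    (hmono hs).trans_eq hη.crossing_time⟩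

theorem interface_pos (hη : P.IsTwoPhaseDilation x u₁ u₂ τ η) (h : P.IsAdmissible x u₁ u₂ τ)
    {s : I} (hs : 0 < s) : 0 < P.g (η.2 s).1.1 (η.2 s).1.2.1 := by
  have hmono := hη.trajectory₂.isPrimitive_time.strictMono hη.dilation₂.speed_pos
  rw [hη.dilation₂.state]
  exact h.after _ ⟨hη.time_two_zero.symm.trans_lt (hmono hs),
    (hmono.monotone s.2.2).trans_eq hη.final_time⟩

theorem eventually_interface_neg (hη : P.IsTwoPhaseDilation x u₁ u₂ τ η) (hP : P.IsSmooth)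
    (h : P.IsAdmissible x u₁ u₂ τ) (htrans : P.IsTransversal x u₁ u₂ τ) :
    ∀ᶠ γ in 𝓝 η.1, IsTrajectory (dilatedField P.f₁ P.L₁) γ → P.g (γ 1).1.1 (γ 1).1.2.1 = 0 →
      ∀ s < 1, P.g (γ s).1.1 (γ s).1.2.1 < 0 := by
  have hrate := mul_pos (hη.dilation₁.speed_pos 1) (h.crossingSpeed_pos hP htrans).1
  rw [← hη.crossing_time, ← hη.dilation₁.state, ← hη.dilation₁.control] at hrate
  filter_upwards [eventually_forall_lt_one_neg hP.continuous_interface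
    (hP.continuous_interface_rate hP.f₁.continuous) (fun s hs => hη.interface_neg h hs) hrate]
    with γ hγ htraj
  exact hγ (hP.isPrimitive_interface htraj)

theorem eventually_interface_pos (hη : P.IsTwoPhaseDilation x u₁ u₂ τ η) (hP : P.IsSmooth)
    (h : P.IsAdmissible x u₁ u₂ τ) (htrans : P.IsTransversal x u₁ u₂ τ) :
    ∀ᶠ γ in 𝓝 η.2, IsTrajectory (dilatedField P.f₂ P.L₂) γ → P.g (γ 0).1.1 (γ 0).1.2.1 = 0 →
      ∀ s > 0, 0 < P.g (γ s).1.1 (γ s).1.2.1 := by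
  have hrate := mul_pos (hη.dilation₂.speed_pos 0) (h.crossingSpeed_pos hP htrans).2
  rw [← hη.time_two_zero, ← hη.dilation₂.state, ← hη.dilation₂.control] at hrate
  filter_upwards [eventually_forall_pos_pos hP.continuous_interface
    (hP.continuous_interface_rate hP.f₂.continuous) (fun s hs => hη.interface_pos h hs) hrate]
    with γ hγ htraj
  exact hγ (hP.isPrimitive_interface htraj)

theorem eventually_exists_isAdmissible (hη : P.IsTwoPhaseDilation x u₁ u₂ τ η) (hP : P.IsSmooth)
    (h : P.IsAdmissible x u₁ u₂ τ) (htrans : P.IsTransversal x u₁ u₂ τ) :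
    ∀ᶠ ζ in 𝓝 η, IsTrajectory (dilatedField P.f₁ P.L₁) ζ.1 →
      IsTrajectory (dilatedField P.f₂ P.L₂) ζ.2 →
      P.endpointConstraint (twoPhaseEndpointsCLM ζ) = 0 →
      ∃ y v₁ v₂ r, P.IsTwoPhaseDilation y v₁ v₂ r ζ ∧ P.IsAdmissible y v₁ v₂ r := by
  have hspeed : Continuous fun z : PhaseState n × EuclideanSpace ℝ (Fin k) × ℝ => z.2.2 :=
    continuous_snd.snd
  filter_upwards [continuousAt_fst.eventually
      (eventually_forall_pos hspeed hη.dilation₁.speed_pos),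
    continuousAt_snd.eventually (eventually_forall_pos hspeed hη.dilation₂.speed_pos),
    continuousAt_fst.eventually (hη.eventually_interface_neg hP h htrans),
    continuousAt_snd.eventually (hη.eventually_interface_pos hP h htrans)]
    with ζ hspeed₁ hspeed₂ hneg hpos hζ₁ hζ₂ hconstr
  obtain ⟨-, hmatch, hcross, -⟩ := endpointConstraint_eq_zero_iff.1 hconstr
  change (ζ.2 0).1 = (ζ.1 1).1 at hmatch
  exact exists_isTwoPhaseDilation_isAdmissible hζ₁ hζ₂ hspeed₁ hspeed₂ hconstr
    (hneg hζ₁ hcross) (hpos hζ₂ (by rwa [hmatch]))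

theorem isLocalExtrOn (hη : P.IsTwoPhaseDilation x u₁ u₂ τ η) (hP : P.IsSmooth)
    (hopt : P.IsOptimal x u₁ u₂ τ) (htrans : P.IsTransversal x u₁ u₂ τ) :
    IsLocalExtrOn (P.endpointCost ∘ twoPhaseEndpointsCLM)
      {ζ | (IsTrajectory (dilatedField P.f₁ P.L₁) ζ.1 ∧ IsTrajectory (dilatedField P.f₂ P.L₂) ζ.2) ∧
        P.endpointConstraint (twoPhaseEndpointsCLM ζ) =
          P.endpointConstraint (twoPhaseEndpointsCLM η)} η := by
  have hnear := hη.eventually_exists_isAdmissible hP hopt.1 htrans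
  refine hopt.2.imp (fun hmin => ?_) fun hmax => ?_
  all_goals
    filter_upwards [nhdsWithin_le_nhds hnear, self_mem_nhdsWithin] with ζ hζ hmem
    obtain ⟨y, v₁, v₂, r, hdil, hadm⟩ :=
      hζ hmem.1.1 hmem.1.2 (hmem.2.trans (hη.endpointConstraint_eq_zero hopt.1))
    simp only [Function.comp_apply, hη.endpointCost_eq hP hopt.1, hdil.endpointCost_eq hP hadm]
  · exact hmin y v₁ v₂ r hadm
  · exact hmax y v₁ v₂ r hadm

theorem lagrange_fderiv_apply (hη : P.IsTwoPhaseDilation x u₁ u₂ τ η) (hP : P.IsSmooth)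
    (Λ : PhaseState n × PhaseState n × ℝ × P.Wᗮ × ℝ →L[ℝ] ℝ) (c : ℝ)
    (δ : (PhaseState n × PhaseState n) × PhaseState n × PhaseState n) :
    (Λ ∘L fderiv ℝ P.endpointConstraint (twoPhaseEndpointsCLM η) +
        c • fderiv ℝ P.endpointCost (twoPhaseEndpointsCLM η)) δ =
      Λ (δ.1.1, δ.2.1 - δ.1.2,
        inner ℝ (P.normal (x τ) τ) δ.1.2.1 + P.timeSlope (x τ) τ * δ.1.2.2.1,
        P.Wᗮ.orthogonalProjectionOnto δ.2.2.1, δ.2.2.2.1) +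
      c * (inner ℝ (gradient P.φ (x P.t_f)) δ.2.2.1 + δ.2.2.2.2) := by
  have htime : (twoPhaseEndpointsCLM η).1.2.2.1 = τ := hη.crossing_time
  have hcross : (twoPhaseEndpointsCLM η).1.2.1 = x τ :=
    (hη.dilation₁.state 1).trans (congrArg x hη.crossing_time)
  have hfinal : (twoPhaseEndpointsCLM η).2.2.1 = x P.t_f :=
    (hη.dilation₂.state 1).trans (congrArg x hη.final_time)
  simp only [add_apply, smul_apply, ContinuousLinearMap.comp_apply, smul_eq_mul,
    hP.fderiv_endpointConstraint_apply, hP.fderiv_endpointCost_apply, htime, hcross, hfinal]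

end IsTwoPhaseDilation

/-- `c` is the multiplier of the cost, `Λ` that of the end point constraint, and `p₁`, `p₂` are the
co-states of the phases: the augmented co-states at the end points of the phases are the
derivatives, up to sign, of the Lagrange function with respect to these end points. -/
structure IsMultiplier (P : SwitchedProblem n k) (x : ℝ → EuclideanSpace ℝ (Fin n))
    (u₁ u₂ : ℝ → EuclideanSpace ℝ (Fin k)) (τ c : ℝ)
    (Λ : PhaseState n × PhaseState n × ℝ × P.Wᗮ × ℝ →L[ℝ] ℝ)
    (p₁ p₂ : ℝ → EuclideanSpace ℝ (Fin n)) : Prop where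
  costate₁ : IsPhaseCostate P.f₁ P.L₁ c x u₁ P.t₀ τ p₁
  costate₂ : IsPhaseCostate P.f₂ P.L₂ c x u₂ τ P.t_f p₂
  initial : ∀ ζ, augmentedCostate P.f₁ P.L₁ c x u₁ p₁ P.t₀ ζ = -Λ (ζ, 0, 0, 0, 0)
  before : ∀ ζ, augmentedCostate P.f₁ P.L₁ c x u₁ p₁ τ ζ =
    Λ (0, -ζ, inner ℝ (P.normal (x τ) τ) ζ.1 + P.timeSlope (x τ) τ * ζ.2.1, 0, 0)
  after : ∀ ζ, augmentedCostate P.f₂ P.L₂ c x u₂ p₂ τ ζ = -Λ (0, ζ, 0, 0, 0)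
  terminal : ∀ ζ, augmentedCostate P.f₂ P.L₂ c x u₂ p₂ P.t_f ζ =
    Λ (0, 0, 0, P.Wᗮ.orthogonalProjectionOnto ζ.1, ζ.2.1) +
      c * (inner ℝ (gradient P.φ (x P.t_f)) ζ.1 + ζ.2.2)

theorem IsOptimal.exists_isMultiplier (hP : P.IsSmooth) (hopt : P.IsOptimal x u₁ u₂ τ)
    (htrans : P.IsTransversal x u₁ u₂ τ) :
    ∃ c Λ p₁ p₂, (c = 1 ∨ c = 0 ∧ Λ ≠ 0) ∧ P.IsMultiplier x u₁ u₂ τ c Λ p₁ p₂ := by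
  obtain ⟨η, hη⟩ := hopt.1.exists_isTwoPhaseDilation hP
  obtain ⟨Λ, c, q₁, q₂, hc, hq₁, hq₂⟩ := exists_isAdjointArc_of_isLocalExtrOn
    (contDiff_dilatedField hP.f₁ hP.L₁) (contDiff_dilatedField hP.f₂ hP.L₂)
    hη.trajectory₁ hη.trajectory₂
    (hP.contDiff_endpointConstraint.contDiffAt.hasStrictFDerivAt one_ne_zero)
    (hP.contDiff_endpointCost.contDiffAt.hasStrictFDerivAt one_ne_zero)
    (hη.isLocalExtrOn hP hopt htrans)
  obtain ⟨p₁, c₁, hp₁, haug₁⟩ := hq₁.exists_isPhaseCostate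
    ((contDiff_extendedVelocity hP.f₁ hP.L₁).differentiable one_ne_zero) hη.trajectory₁
    hη.dilation₁
  obtain ⟨p₂, c₂, hp₂, haug₂⟩ := hq₂.exists_isPhaseCostate
    ((contDiff_extendedVelocity hP.f₂ hP.L₂).differentiable one_ne_zero) hη.trajectory₂
    hη.dilation₂
  rw [hη.time_one_zero, hη.crossing_time] at hp₁
  rw [hη.time_two_zero, hη.final_time] at hp₂
  have hinitial (ζ) : augmentedCostate P.f₁ P.L₁ c₁ x u₁ p₁ P.t₀ ζ = -Λ (ζ, 0, 0, 0, 0) := by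
    rw [← hη.time_one_zero, ← haug₁ 0, hq₁.apply_zero]
    exact congrArg Neg.neg ((hη.lagrange_fderiv_apply hP Λ c ((ζ, 0), 0)).trans (by simp))
  have hbefore (ζ) : augmentedCostate P.f₁ P.L₁ c₁ x u₁ p₁ τ ζ =
      Λ (0, -ζ, inner ℝ (P.normal (x τ) τ) ζ.1 + P.timeSlope (x τ) τ * ζ.2.1, 0, 0) := by
    rw [← congrArg (augmentedCostate P.f₁ P.L₁ c₁ x u₁ p₁) hη.crossing_time, ← haug₁ 1,
      hq₁.apply_one]
    exact (hη.lagrange_fderiv_apply hP Λ c ((0, ζ), 0)).trans (by simp)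
  have hafter (ζ) : augmentedCostate P.f₂ P.L₂ c₂ x u₂ p₂ τ ζ = -Λ (0, ζ, 0, 0, 0) := by
    rw [← congrArg (augmentedCostate P.f₂ P.L₂ c₂ x u₂ p₂) hη.time_two_zero, ← haug₂ 0,
      hq₂.apply_zero]
    exact congrArg Neg.neg ((hη.lagrange_fderiv_apply hP Λ c (0, (ζ, 0))).trans (by simp))
  have hterminal (ζ) : augmentedCostate P.f₂ P.L₂ c₂ x u₂ p₂ P.t_f ζ =
      Λ (0, 0, 0, P.Wᗮ.orthogonalProjectionOnto ζ.1, ζ.2.1) +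
        c * (inner ℝ (gradient P.φ (x P.t_f)) ζ.1 + ζ.2.2) := by
    rw [← congrArg (augmentedCostate P.f₂ P.L₂ c₂ x u₂ p₂) hη.final_time, ← haug₂ 1,
      hq₂.apply_one]
    exact (hη.lagrange_fderiv_apply hP Λ c (0, (0, ζ))).trans (by simp)
  obtain rfl : c₂ = c := by
    simpa [augmentedCostate_apply, Prod.mk_zero_zero] using hterminal (0, 0, 1)
  obtain rfl : c₁ = c₂ := by
    have hcost := (hbefore (0, 0, 1)).trans (Eq.trans (by simp) ((map_neg Λ _).trans
      (hafter (0, 0, 1)).symm))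
    simpa only [augmentedCostate_apply, inner_zero_right, mul_zero, sub_zero, zero_add, mul_one]
      using hcost
  exact ⟨_, Λ, p₁, p₂, hc, hp₁, hp₂, hinitial, hbefore, hafter, hterminal⟩

end Multipliers

section ScaledCost

/-- The problem with all costs multiplied by `c`, which interpolates between the given problem
(`c = 1`) and the abnormal one (`c = 0`). -/
def scaleCost (P : SwitchedProblem n k) (c : ℝ) : SwitchedProblem n k :=
  { P with
    L₁ := fun y u t => c * P.L₁ y u t
    L₂ := fun y u t => c * P.L₂ y u t
    φ := fun y => c * P.φ y }

theorem scaleCost_one : P.scaleCost 1 = P := by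
  simp [scaleCost]

theorem scaleCost_zero : P.scaleCost 0 = P.withoutCost := by
  simp [scaleCost, withoutCost]

end ScaledCost

namespace IsMultiplier

variable {c : ℝ} {Λ : PhaseState n × PhaseState n × ℝ × P.Wᗮ × ℝ →L[ℝ] ℝ}
  {p₁ p₂ : ℝ → EuclideanSpace ℝ (Fin n)}

theorem augmentedCostate_jump (h : P.IsMultiplier x u₁ u₂ τ c Λ p₁ p₂) (ζ : PhaseState n) :
    augmentedCostate P.f₂ P.L₂ c x u₂ p₂ τ ζ - augmentedCostate P.f₁ P.L₁ c x u₁ p₁ τ ζ =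
      -(Λ (0, 0, 1, 0, 0) *
        (inner ℝ (P.normal (x τ) τ) ζ.1 + P.timeSlope (x τ) τ * ζ.2.1)) := by
  rw [h.after, h.before, mul_comm (Λ _), ← smul_eq_mul (_ + _), ← map_smul, ← map_neg, ← map_neg,
    ← map_sub]
  simp [Prod.mk_zero_zero]

theorem isCostate (h : P.IsMultiplier x u₁ u₂ τ c Λ p₁ p₂) (hφ : Differentiable ℝ P.φ) :
    (P.scaleCost c).IsCostate x u₁ u₂ τ p₁ p₂ (Λ (0, 0, 1, 0, 0)) where
  adjoint₁ := h.costate₁.adjoint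
  adjoint₂ := h.costate₂.adjoint
  stationary₁ := h.costate₁.stationary
  stationary₂ := h.costate₂.stationary
  terminal := by
    change p₂ P.t_f - gradient (fun y => c * P.φ y) (x P.t_f) ∈ P.Wᗮ
    refine (Submodule.mem_orthogonal' _ _).2 fun v hv => ?_
    have hproj : P.Wᗮ.orthogonalProjectionOnto v = 0 := by
      rwa [Submodule.orthogonalProjectionOnto_eq_zero_iff, Submodule.orthogonal_orthogonal]
    have hterminal := h.terminal (v, 0, 0)
    rw [inner_sub_left, sub_eq_zero, inner_gradient_left, fderiv_const_mul (hφ _)]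
    simpa [augmentedCostate_apply, hproj, inner_gradient_left, Prod.mk_zero_zero] using hterminal
  jump := by
    refine ext_inner_right ℝ fun v => ?_
    have hjump := h.augmentedCostate_jump (v, 0, 0)
    simp only [augmentedCostate_apply, mul_zero, sub_zero, add_zero] at hjump
    rw [inner_add_left, inner_sub_left, hjump, real_inner_smul_left, inner_zero_left]
    exact neg_add_cancel _
  hamiltonian := by
    have hjump := h.augmentedCostate_jump (0, 1, 0)
    simp only [augmentedCostate_apply, inner_zero_right, mul_one, mul_zero, zero_add, add_zero,
      zero_sub] at hjump
    change hamiltonian P.f₂ P.L₂ c (x τ) (p₂ τ) (u₂ τ) τ -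
      hamiltonian P.f₁ P.L₁ c (x τ) (p₁ τ) (u₁ τ) τ = Λ (0, 0, 1, 0, 0) * P.timeSlope (x τ) τ
    linarith

theorem eq_zero (h : P.IsMultiplier x u₁ u₂ τ 0 Λ p₁ p₂) (h₀ : p₁ P.t₀ = 0) (hτ : p₂ τ = 0)
    (h_f : p₂ P.t_f = 0) (hν : Λ (0, 0, 1, 0, 0) = 0) : Λ = 0 := by
  have hinitial (ζ) : Λ (ζ, 0, 0, 0, 0) = 0 := by
    simpa [augmentedCostate_apply, hamiltonian, h₀] using (h.initial ζ).symm
  have hmatching (ζ) : Λ (0, ζ, 0, 0, 0) = 0 := by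
    simpa [augmentedCostate_apply, hamiltonian, hτ] using (h.after ζ).symm
  have hterminal (w : P.Wᗮ) (r : ℝ) : Λ (0, 0, 0, w, r) = 0 := by
    simpa [augmentedCostate_apply, hamiltonian, h_f] using (h.terminal (w, r, 0)).symm
  refine ContinuousLinearMap.ext fun ⟨ζ, ζ', r, w, r'⟩ => ?_
  have hsplit : ((ζ, ζ', r, w, r') : PhaseState n × PhaseState n × ℝ × P.Wᗮ × ℝ) =
      (ζ, 0, 0, 0, 0) + (0, ζ', 0, 0, 0) + r • (0, 0, 1, 0, 0) + (0, 0, 0, w, r') := by simp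
  rw [hsplit, map_add, map_add, map_add, map_smul, hinitial, hmatching, hν, hterminal]
  simp

end IsMultiplier

section Normality

variable {p₁ p₂ : ℝ → EuclideanSpace ℝ (Fin n)} {c ν : ℝ}

theorem IsCostate.isPhaseCostate₁ (h : (P.scaleCost c).IsCostate x u₁ u₂ τ p₁ p₂ ν) :
    IsPhaseCostate P.f₁ P.L₁ c x u₁ P.t₀ τ p₁ :=
  ⟨h.adjoint₁, h.stationary₁⟩

theorem IsCostate.isPhaseCostate₂ (h : (P.scaleCost c).IsCostate x u₁ u₂ τ p₁ p₂ ν) :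
    IsPhaseCostate P.f₂ P.L₂ c x u₂ τ P.t_f p₂ :=
  ⟨h.adjoint₂, h.stationary₂⟩

theorem IsCostate.multiplier_eq_zero (h : P.withoutCost.IsCostate x u₁ u₂ τ p₁ p₂ ν)
    (htrans : P.IsTransversal x u₁ u₂ τ) (hτ : p₂ τ = 0) : ν = 0 := by
  have hjump : p₁ τ = ν • P.normal (x τ) τ := by
    have h' : p₂ τ - p₁ τ + ν • P.normal (x τ) τ = 0 := h.jump
    rwa [hτ, zero_sub, neg_add_eq_zero] at h'
  have hhamiltonian : 0 + inner ℝ (p₂ τ) (P.f₂ (x τ) (u₂ τ) τ) -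
      (0 + inner ℝ (p₁ τ) (P.f₁ (x τ) (u₁ τ) τ)) = ν * P.timeSlope (x τ) τ := h.hamiltonian
  rw [hτ, hjump, inner_zero_left, real_inner_smul_left] at hhamiltonian
  exact (mul_eq_zero.1 (by linarith)).resolve_right htrans.1

theorem IsAdmissible.isNormal_of_eq_top (h : P.IsAdmissible x u₁ u₂ τ) (hP : P.IsSmooth)
    (htrans : P.IsTransversal x u₁ u₂ τ) (hW : P.W = ⊤) : P.IsNormal x u₁ u₂ τ := by
  intro p₁ p₂ ν hcostate
  have hscaled := P.scaleCost_zero.symm ▸ hcostate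
  have hterminal : p₂ P.t_f = 0 := by
    have h' : p₂ P.t_f - gradient (fun _ => (0 : ℝ)) (x P.t_f) ∈ P.Wᗮ := hcostate.terminal
    simpa [hW, gradient] using h'
  have hzero₂ := hscaled.isPhaseCostate₂.eqOn_zero h.isPhase₂ hP.f₂ hterminal
  have hτ := hzero₂ (left_mem_Icc.2 h.mem_Ioo.2.le)
  have hν := hcostate.multiplier_eq_zero htrans hτ
  have hτ₁ : p₁ τ = 0 := by simpa [hτ, hν] using hcostate.jump
  exact ⟨hscaled.isPhaseCostate₁.eqOn_zero h.isPhase₁ hP.f₁ hτ₁, hzero₂⟩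

end Normality

theorem IsOptimal.exists_isCostate (hopt : P.IsOptimal x u₁ u₂ τ) (hP : P.IsSmooth)
    (htrans : P.IsTransversal x u₁ u₂ τ) (hnormal : P.IsNormal x u₁ u₂ τ) :
    ∃ p₁ p₂ ν, P.IsCostate x u₁ u₂ τ p₁ p₂ ν := by
  obtain ⟨c, Λ, p₁, p₂, hc, hmult⟩ := hopt.exists_isMultiplier hP htrans
  have hcostate := hmult.isCostate (hP.φ.differentiable one_ne_zero)
  rcases hc with rfl | ⟨rfl, hΛ⟩
  · exact ⟨p₁, p₂, _, P.scaleCost_one ▸ hcostate⟩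
  · rw [scaleCost_zero] at hcostate
    obtain ⟨hzero₁, hzero₂⟩ := hnormal p₁ p₂ _ hcostate
    have hτ := hzero₂ τ (left_mem_Icc.2 hopt.1.mem_Ioo.2.le)
    exact absurd (hmult.eq_zero (hzero₁ P.t₀ (left_mem_Icc.2 hopt.1.mem_Ioo.1.le)) hτ
      (hzero₂ P.t_f (right_mem_Icc.2 hopt.1.mem_Ioo.2.le))
      (hcostate.multiplier_eq_zero htrans hτ)) hΛ

theorem IsCostate.jumpLaw {p₁ p₂ : ℝ → EuclideanSpace ℝ (Fin n)} {ν : ℝ}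
    (h : P.IsCostate x u₁ u₂ τ p₁ p₂ ν)
    (hpos : 0 < (1 / 2 : ℝ) * (P.crossingSpeed P.f₁ (x τ) (u₁ τ) τ +
      P.crossingSpeed P.f₂ (x τ) (u₂ τ) τ)) :
    P.JumpLaw x u₁ u₂ τ p₁ p₂ := by
  have hjump : p₂ τ = p₁ τ - ν • P.normal (x τ) τ := by
    rw [eq_sub_iff_add_eq, ← sub_eq_zero, ← h.jump]
    abel
  have hhamiltonian := h.hamiltonian
  have hν : (P.L₂ (x τ) (u₂ τ) τ - P.L₁ (x τ) (u₁ τ) τ +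
      inner ℝ ((1 / 2 : ℝ) • (p₁ τ + p₂ τ)) (P.f₂ (x τ) (u₂ τ) τ - P.f₁ (x τ) (u₁ τ) τ)) /
      ((1 / 2 : ℝ) * (P.crossingSpeed P.f₁ (x τ) (u₁ τ) τ +
        P.crossingSpeed P.f₂ (x τ) (u₂ τ) τ)) = ν := by
    rw [div_eq_iff hpos.ne']
    simp only [H₁, H₂, crossingSpeed, hjump, inner_add_left, inner_sub_left, inner_sub_right,
      real_inner_smul_left] at hhamiltonian ⊢
    linarith
  have hdiff : p₂ τ - p₁ τ = -ν • P.normal (x τ) τ := by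
    rw [hjump, neg_smul, sub_sub_cancel_left]
  exact hdiff.trans (congrArg (fun r => -r • P.normal (x τ) τ) hν.symm)

end SwitchedProblem

theorem mainTheorem3 {n k : ℕ} (P : SwitchedProblem n k) (hP : P.IsSmooth)
    (x : ℝ → EuclideanSpace ℝ (Fin n)) (u₁ u₂ : ℝ → EuclideanSpace ℝ (Fin k)) (τ : ℝ)
    (hopt : P.IsOptimal x u₁ u₂ τ)
    (htrans : P.IsTransversal x u₁ u₂ τ)
    (hnormal : P.W = ⊤ ∨ P.IsNormal x u₁ u₂ τ) :
    0 < (1 / 2 : ℝ) *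
        ((inner ℝ (P.normal (x τ) τ) (P.f₁ (x τ) (u₁ τ) τ) + P.timeSlope (x τ) τ) +
          (inner ℝ (P.normal (x τ) τ) (P.f₂ (x τ) (u₂ τ) τ) + P.timeSlope (x τ) τ)) ∧
      (∃ p₁ p₂ ν, P.IsCostate x u₁ u₂ τ p₁ p₂ ν) ∧
      (∀ p₁ p₂ ν, P.IsCostate x u₁ u₂ τ p₁ p₂ ν → P.JumpLaw x u₁ u₂ τ p₁ p₂) := by
  have hadm := hopt.1
  obtain ⟨hspeed₁, hspeed₂⟩ := hadm.crossingSpeed_pos hP htrans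
  have hpos := mul_pos (one_half_pos (α := ℝ)) (add_pos hspeed₁ hspeed₂)
  have hnormal' : P.IsNormal x u₁ u₂ τ :=
    hnormal.elim (fun hW => hadm.isNormal_of_eq_top hP htrans hW) id
  exact ⟨hpos, hopt.exists_isCostate hP htrans hnormal', fun p₁ p₂ ν h => h.jumpLaw hpos⟩
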